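/- **Theorem.** Let $r\le n$, let $f\in C^{4n}(\mathbb R^n\times\mathbb R^r;\mathbb R^n)$ with $f(0,0)=0$, put $A=\frac{\partial f}{\partial x}(0,0)$, $B=\frac{\partial f}{\partial u}(0,0)$, and assume $\operatorname{rank}(B,AB,\dots,A^{n-1}B)=n$. Let $N>0$. For $\bar x\in\mathbb R^n$ define $\phi^{(1)},\dots,\phi^{(4n-1)}\in\mathbb R^n$ recursively: $\phi^{(k+1)}$ is $-\frac1{k+1}$ times the coefficient of $s^k$ in the Taylor expansion at $s=0$ of $f\big(\bar x+\sum_{j=1}^{k}s^j\phi^{(j)},0\big)$ (so $\phi^{(1)}=-f(\bar x,0)$). Put $p(s)=\sum_{k=1}^{4n-1}s^k\phi^{(k)}$. For $\alpha>0$ and $\tau\ge 0$ let $$P(\tau)=\alpha e^{-\alpha\tau}\sum_{i=0}^{n-1}e^{-i\alpha\tau}P_{i+1},\qquad Q(\tau)=\alpha e^{-\alpha\tau}\sum_{i=0}^{2n-1}e^{-i\alpha\tau}Q_{i+1},$$ where $P_{i+1}$ and $Q_{i+1}$ are the coefficients of $s^i$ in the Taylor expansions at $s=0$ of $\frac{\partial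 f}{\partial x}(\bar x+p(s),0)$ and $\frac{\partial f}{\partial u}(\bar x+p(s),0)$ respectively. Then there are $\varepsilon>0$ and $\alpha>0$ such that for every $\bar x\in\mathbb R^n$ with $\|\bar x\|<\varepsilon$ there are a continuous matrix function $M(\tau)$, $\tau\ge0$, and functions $y:[0,\infty)\to\mathbb R^n$, $x:[0,1]\to\mathbb R^n$, $u:[0,1]\to\mathbb R^r$ with the following properties. 1. The feedback $d=M(\tau)c$ stabilizes the linear non-stationary system $\frac{dc}{d\tau}=P(\tau)c+Q(\tau)d$: the fundamental matrix $\Phi$, $\Phi(0)=I$, of $\frac{dc}{d\tau}=(P(\tau)+Q(\tau)M(\tau))c$ satisfies $\|\Phi(\tau)\|\le Ke^{-\lambda\tau}$ for all $\tau\ge0$, with some $K,\lambda>0$. 2. $y$ is the unique solution on $[0,\infty)$ of the auxiliary initial value problem $$\frac{dy}{d\tau}=\alpha e^{-\alpha\tau}\Big(f\big(\bar x+p(e^{-\alpha\tau})+y,\;M(\tau)y\big)+p'(e^{-\alpha\tau})\Big),\qquad y(0)=-\bar x-p(1).$$ 3. For all $\tau\ge0$, $x(1-e^{-\alpha\tau})=\bar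 x+p(e^{-\alpha\tau})+y(\tau)$ and $u(1-e^{-\alpha\tau})=M(\tau)y(\tau)$. 4. $x$ and $u$ are continuous on $[0,1]$ and $\dot x(t)=f(x(t),u(t))$, $\|u(t)\|<N$ for all $t\in[0,1]$ (one-sided derivatives at the end points), $x(0)=0$ and $x(1)=\bar x$. -/

import Mathlib

open Set

noncomputable section

namespace TransferControl

/-- Euclidean space `ℝ^k`. -/
abbrev Vec (k : ℕ) : Type := EuclideanSpace ℝ (Fin k)

/-- The matrix `A = ∂f/∂x (0,0)` of partial derivatives. -/
def matA {n r : ℕ} (f : Vec n × Vec r → Vec n) : Matrix (Fin n) (Fin n) ℝ :=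
  Matrix.of fun i j => (fderiv ℝ f (0, 0) (EuclideanSpace.single j 1, 0)) i

/-- The matrix `B = ∂f/∂u (0,0)` of partial derivatives. -/
def matB {n r : ℕ} (f : Vec n × Vec r → Vec n) : Matrix (Fin n) (Fin r) ℝ :=
  Matrix.of fun i j => (fderiv ℝ f (0, 0) (0, EuclideanSpace.single j 1)) i

/-- The block matrix `S = (B, AB, A²B, …, A^{n-1}B)`; its column `(k, j)` is the `j`-th column
of `A^k B`. -/
def kalmanMatrix {n r : ℕ} (A : Matrix (Fin n) (Fin n) ℝ) (B : Matrix (Fin n) (Fin r) ℝ) :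
    Matrix (Fin n) (Fin n × Fin r) ℝ :=
  Matrix.of fun i kj => (A ^ (kj.1 : ℕ) * B) i kj.2

/-- The pair `x, u` is a solution on `[0,1]` of the problem `ẋ = f(x,u)`, `x(0) = 0`,
`x(1) = xbar`, with continuous `x`, `u` and with `‖u‖ < N`. At the end points of `[0,1]` the
derivative is one-sided. -/
structure IsSolution {n r : ℕ} (f : Vec n × Vec r → Vec n) (N : ℝ) (xbar : Vec n)
    (x : ℝ → Vec n) (u : ℝ → Vec r) : Prop where
  continuousOn_state : ContinuousOn x (Icc 0 1)
  continuousOn_control : ContinuousOn u (Icc 0 1)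
  ode : ∀ t ∈ Icc (0 : ℝ) 1, HasDerivWithinAt x (f (x t, u t)) (Icc 0 1) t
  control_bound : ∀ t ∈ Icc (0 : ℝ) 1, ‖u t‖ < N
  initial : x 0 = 0
  terminal : x 1 = xbar

/-- The sum `s φ⁽¹⁾ + s² φ⁽²⁾ + … + s^k φ⁽ᵏ⁾` of the first `k` successive shifts, where
`s = exp (-α τ)`. The next coefficient `φ⁽ᵏ⁺¹⁾` is `-1/(k+1)` times the coefficient of `s^k` in
the Taylor expansion at `s = 0` of `f (xbar + s φ⁽¹⁾ + … + s^k φ⁽ᵏ⁾, 0)`. So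
`φ⁽¹⁾ = -f (xbar, 0)`, `φ⁽²⁾ = (1/2) ∂f/∂x (xbar, 0) f (xbar, 0)`, and so on: each shift removes
the free terms of lowest order in `s` from the equation. -/
def shift {n r : ℕ} (f : Vec n × Vec r → Vec n) (xbar : Vec n) : ℕ → ℝ → Vec n
  | 0 => fun _ => 0
  | k + 1 => fun s => shift f xbar k s
      - (s ^ (k + 1) / ((k + 1).factorial : ℝ)) •
          iteratedDeriv k (fun σ : ℝ => f (xbar + shift f xbar k σ, 0)) 0

/-- The total shift `∑ s^k φ⁽ᵏ⁾`, `k = 1, …, 4n-1`. -/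
def totalShift {n r : ℕ} (f : Vec n × Vec r → Vec n) (xbar : Vec n) : ℝ → Vec n :=
  shift f xbar (4 * n - 1)

/-- `∂f/∂x (z, 0)`. -/
def partialX {n r : ℕ} (f : Vec n × Vec r → Vec n) (z : Vec n) : Vec n →L[ℝ] Vec n :=
  (fderiv ℝ f (z, 0)).comp (ContinuousLinearMap.inl ℝ (Vec n) (Vec r))

/-- `∂f/∂u (z, 0)`. -/
def partialU {n r : ℕ} (f : Vec n × Vec r → Vec n) (z : Vec n) : Vec r →L[ℝ] Vec n :=
  (fderiv ℝ f (z, 0)).comp (ContinuousLinearMap.inr ℝ (Vec n) (Vec r))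

/-- The coefficient `P(τ) = α e^{-ατ} (P₁ + e^{-ατ} P₂ + … + e^{-(n-1)ατ} Pₙ)`: the terms with
factors `e^{-iατ}`, `i = 1, …, n`, of the part of the shifted system that is linear in the
state. -/
def coeffP {n r : ℕ} (f : Vec n × Vec r → Vec n) (xbar : Vec n) (α τ : ℝ) : Vec n →L[ℝ] Vec n :=
  (α * Real.exp (-α * τ)) • ∑ i ∈ Finset.range n,
    (Real.exp (-α * τ) ^ i / (i.factorial : ℝ)) •
      iteratedDeriv i (fun σ : ℝ => partialX f (xbar + totalShift f xbar σ)) 0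

/-- The coefficient `Q(τ) = α e^{-ατ} (Q₁ + e^{-ατ} Q₂ + … + e^{-(2n-1)ατ} Q₂ₙ)`: the terms with
factors `e^{-iατ}`, `i = 1, …, 2n`, of the part of the shifted system that is linear in the
control. -/
def coeffQ {n r : ℕ} (f : Vec n × Vec r → Vec n) (xbar : Vec n) (α τ : ℝ) : Vec r →L[ℝ] Vec n :=
  (α * Real.exp (-α * τ)) • ∑ i ∈ Finset.range (2 * n),
    (Real.exp (-α * τ) ^ i / (i.factorial : ℝ)) •
      iteratedDeriv i (fun σ : ℝ => partialU f (xbar + totalShift f xbar σ)) 0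

/-- The continuous feedback `d = M(τ) c`, `τ ≥ 0`, stabilizes the linear non-stationary system
`dc/dτ = P(τ) c + Q(τ) d`: the fundamental matrix `Φ`, `Φ(0) = I`, of the closed system
decreases exponentially. -/
def IsStabilizing {n r : ℕ} (P : ℝ → Vec n →L[ℝ] Vec n) (Q : ℝ → Vec r →L[ℝ] Vec n)
    (M : ℝ → Vec n →L[ℝ] Vec r) : Prop :=
  ContinuousOn M (Ici 0) ∧
    ∃ Φ : ℝ → Vec n →L[ℝ] Vec n, Φ 0 = ContinuousLinearMap.id ℝ (Vec n) ∧
      (∀ τ ∈ Ici (0 : ℝ),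
        HasDerivWithinAt Φ ((P τ + (Q τ).comp (M τ)).comp (Φ τ)) (Ici 0) τ) ∧
      ∃ K > 0, ∃ lam > 0, ∀ τ ∈ Ici (0 : ℝ), ‖Φ τ‖ ≤ K * Real.exp (-lam * τ)

/-- `y` solves on `[0, ∞)` the auxiliary initial value problem: the equation obtained from
`ẋ = f(x,u)` by the substitutions `t = 1 - s`, `s = e^{-ατ}`,
`x = xbar + totalShift s + y`, `u = M(τ) y`, with the initial value that corresponds to
`x(0) = 0`. -/
structure IsAuxSolution {n r : ℕ} (f : Vec n × Vec r → Vec n) (xbar : Vec n) (α : ℝ)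
    (M : ℝ → Vec n →L[ℝ] Vec r) (y : ℝ → Vec n) : Prop where
  initial : y 0 = -xbar - totalShift f xbar 1
  ode : ∀ τ ∈ Ici (0 : ℝ), HasDerivWithinAt y
    ((α * Real.exp (-α * τ)) •
      (f (xbar + totalShift f xbar (Real.exp (-α * τ)) + y τ, M τ (y τ))
        + deriv (totalShift f xbar) (Real.exp (-α * τ)))) (Ici 0) τ

end TransferControl

end

/-!
The time `t` is replaced by `s = 1 - t = e^{-τ}`, so `α = 1` works, and the singular point is
`s = 0`. In this variable the linear part of the shifted system is `dc/ds = -(P(s) c + Q(s) d)`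
with polynomials `P` and `Q`.

*Feedback.* The stabilizing feedback comes from a weighted controllability Gramian. With the
sequence `Q_0 = Q`, `Q_(k+1) = Q_k' + P Q_k` (`ctrlSeq`, which is `A^k B` at the origin) put
`W(s) = e^{-Ls} ∑ Z_jk s^(j+k+1) Q_j Q_k*`, where `Z_jk = ∫₀¹ θ^m q_j q_k dθ` and
`q_k = (θ - 1)^k / k!`. An integration by parts gives the recurrence `weight_recurrence`, which
says that `W' + P W + W P* + (m/s) W ≤ Q Q*`; the only error is a boundary term, which the factor
`e^{-Ls}` absorbs (`exists_isGramian`). The rank condition is open and hence holds uniformly near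
the origin (`eventually_ctrlSeq_bounds`); it makes the quadratic form of `W` at least of order
`s^(2n-1)`, while `‖W η‖²` is at most of order `s ⟪η, W η⟫`. With `d = -Q* W⁻¹ c / 2`, the function
`V = ⟪c, W⁻¹ c⟫` satisfies `dV/dτ ≤ -m V` along the linear system, hence the exponential decay of
the fundamental matrix (`IsGramian.exists_fundamental`).

*Perturbation.* The auxiliary equation is the closed linear system with a perturbation made of the
residual `f(x̄ + p(s), 0) + p'(s)`, the truncation errors of `P` and `Q`, of orders `s^n` and
`s^(2n)`, and a quadratic term. The shifts are built so that the Taylor coefficients of the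
residual of orders below `4n - 1` vanish, so the residual is at most `e s^(4n-1)`, with `e` small
for small `x̄` (`residual_le`). For `m = 6n` these orders fit: the growth rate of `V / s^(6n)` is of
order `s^(1/2)` in `τ`, which is integrable, and a comparison argument shows that `V / s^(6n)` stays
as small as its initial value and `e` allow (`IsGramian.lyap_le_of_perturbation`). So the state and
the control `M y` tend to zero as `τ → ∞` and stay uniformly small.

*Existence.* Since the trajectory stays in the unit ball, `f` may be replaced by a globally
Lipschitz function, for which a weighted Picard iteration gives a solution on `[0, ∞)`
(`exists_global_solution`). The substitution `t = 1 - e^{-τ}` returns to `[0, 1]`; the one-sided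
derivative at `t = 1` exists because the derivative has a limit there (`exists_isSolution`).
-/

open Set

noncomputable section

namespace TransferControl

/-! ### Global existence and uniqueness for differential equations -/

section

open MeasureTheory in
/-- Global existence on `[0, ∞)` for an equation whose right-hand side is Lipschitz in the state
with a constant that depends continuously on time. The Picard operator is a contraction of the
bounded continuous functions after division by `exp (∫ (2 K + ‖v · 0‖))`. -/
theorem exists_global_solution {G : Type*} [NormedAddCommGroup G] [NormedSpace ℝ G]
    [CompleteSpace G] (v : ℝ → G → G) (K : ℝ → ℝ) (hK : Continuous K) (hK0 : ∀ t, 0 ≤ K t)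
    (hv : Continuous fun p : ℝ × G => v p.1 p.2)
    (hlip : ∀ t x y, ‖v t x - v t y‖ ≤ K t * ‖x - y‖) (y₀ : G) :
    ∃ y : ℝ → G, y 0 = y₀ ∧ ∀ t, 0 ≤ t → HasDerivAt y (v t (y t)) t := by
  set Λ : ℝ → ℝ := fun t => 2 * K t + ‖v t 0‖ with hΛ
  have hv0 : Continuous fun t => v t 0 :=
    hv.comp (by fun_prop : Continuous fun t : ℝ => (t, (0 : G)))
  have hΛc : Continuous Λ := by fun_prop
  set l : ℝ → ℝ := fun t => ∫ σ in (0 : ℝ)..t, Λ σ with hl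
  have hld : ∀ t, HasDerivAt l (Λ t) t := fun t => hΛc.integral_hasStrictDerivAt 0 t |>.hasDerivAt
  have hlc : Continuous l := continuous_iff_continuousAt.2 fun t => (hld t).continuousAt
  have hexpd : ∀ t, HasDerivAt (fun t => Real.exp (l t)) (Real.exp (l t) * Λ t) t :=
    fun t => (hld t).exp
  have hint : ∀ t, ∫ σ in (0 : ℝ)..t, Real.exp (l σ) * Λ σ = Real.exp (l t) - 1 := by
    intro t
    rw [intervalIntegral.integral_eq_sub_of_hasDerivAt (fun x _ => hexpd x)
      ((by fun_prop : Continuous fun σ => Real.exp (l σ) * Λ σ).intervalIntegrable _ _)]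
    simp [hl]
  have hvz : ∀ z : BoundedContinuousFunction ℝ G,
      Continuous fun σ => v σ (Real.exp (l σ) • z σ) := fun z =>
    hv.comp (by fun_prop : Continuous fun σ : ℝ => (σ, Real.exp (l σ) • z σ))
  -- bound for a primitive of a function that is dominated by `C` times the derivative of `exp l`
  have hbd : ∀ (w : ℝ → G) (C : ℝ), (∀ σ, 0 ≤ σ → ‖w σ‖ ≤ C * (Real.exp (l σ) * Λ σ)) → 0 ≤ C →
      ∀ t, 0 ≤ t → ‖∫ σ in (0 : ℝ)..t, w σ‖ ≤ C * Real.exp (l t) := by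
    intro w C hw hC t ht
    calc ‖∫ σ in (0 : ℝ)..t, w σ‖ ≤ ∫ σ in (0 : ℝ)..t, C * (Real.exp (l σ) * Λ σ) :=
          intervalIntegral.norm_integral_le_of_norm_le ht (Filter.Eventually.of_forall
            fun σ hσ => hw σ hσ.1.le)
            ((by fun_prop : Continuous fun σ => C * (Real.exp (l σ) * Λ σ)).intervalIntegrable _ _)
      _ = C * (Real.exp (l t) - 1) := by rw [intervalIntegral.integral_const_mul, hint]
      _ ≤ C * Real.exp (l t) := by nlinarith
  have hprim : ∀ w : ℝ → G, Continuous w → Continuous fun t => ∫ σ in (0 : ℝ)..t, w σ :=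
    fun w hw => intervalIntegral.continuous_primitive (fun a b => hw.intervalIntegrable a b) 0
  have hdiv : ∀ (t C : ℝ) (g : G), ‖g‖ ≤ C * Real.exp (l t) → ‖Real.exp (-l t) • g‖ ≤ C := by
    intro t C g hg
    rw [norm_smul, Real.norm_eq_abs, abs_of_pos (Real.exp_pos _), Real.exp_neg,
      inv_mul_le_iff₀ (Real.exp_pos _)]
    linarith
  have hl0 : ∀ t, 0 ≤ t → 0 ≤ l t := fun t ht =>
    intervalIntegral.integral_nonneg ht fun σ _ => by have := hK0 σ; positivity
  have hz1 : ∀ (z : BoundedContinuousFunction ℝ G) (σ : ℝ), 0 ≤ σ →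
      ‖v σ (Real.exp (l σ) • z σ)‖ ≤ (1 + ‖z‖) * (Real.exp (l σ) * Λ σ) := by
    intro z σ hσ
    have h1 := hlip σ (Real.exp (l σ) • z σ) 0
    have h2 := norm_le_insert' (v σ (Real.exp (l σ) • z σ)) (v σ 0)
    rw [sub_zero, norm_smul, Real.norm_eq_abs, abs_of_pos (Real.exp_pos _)] at h1
    have h3 : 1 ≤ Real.exp (l σ) := Real.one_le_exp (hl0 _ hσ)
    have h4 := z.norm_coe_le_norm σ
    have h5 := hK0 σ
    have h6 : K σ * (Real.exp (l σ) * ‖z σ‖) ≤ K σ * (Real.exp (l σ) * ‖z‖) := by gcongr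
    have h7 : ‖v σ 0‖ * 1 ≤ ‖v σ 0‖ * Real.exp (l σ) := by gcongr
    have h8 : 0 ≤ K σ * Real.exp (l σ) := by positivity
    have h9 : 0 ≤ K σ * Real.exp (l σ) * ‖z‖ := by positivity
    have h10 : 0 ≤ ‖z‖ * (Real.exp (l σ) * ‖v σ 0‖) := by positivity
    simp only [hΛ]
    linarith
  let T : BoundedContinuousFunction ℝ G → BoundedContinuousFunction ℝ G := fun z =>
    BoundedContinuousFunction.ofNormedAddCommGroup
      (fun t => Real.exp (-l (max t 0)) •
        (y₀ + ∫ σ in (0 : ℝ)..(max t 0), v σ (Real.exp (l σ) • z σ)))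
      (by
        have h1 := (hprim _ (hvz z)).comp (by fun_prop : Continuous fun t : ℝ => max t 0)
        have h2 := hlc.comp (by fun_prop : Continuous fun t : ℝ => max t 0)
        exact (h2.neg.rexp).smul (continuous_const.add h1))
      (‖y₀‖ + (1 + ‖z‖))
      (by
        intro t
        apply hdiv
        have h0 : (0 : ℝ) ≤ max t 0 := le_max_right _ _
        have h1 := hbd _ (1 + ‖z‖) (hz1 z) (by positivity) _ h0
        have h2 : 1 ≤ Real.exp (l (max t 0)) := Real.one_le_exp (hl0 _ h0)
        refine (norm_add_le _ _).trans ?_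
        nlinarith [norm_nonneg y₀])
  have hT : ∀ z t, T z t = Real.exp (-l (max t 0)) •
        (y₀ + ∫ σ in (0 : ℝ)..(max t 0), v σ (Real.exp (l σ) • z σ)) := fun z t => rfl
  have hcontr : ContractingWith (1 / 2) T := by
    refine ⟨by rw [← NNReal.coe_lt_coe]; norm_num, LipschitzWith.of_dist_le_mul fun z w => ?_⟩
    rw [BoundedContinuousFunction.dist_le (by positivity)]
    intro t
    have h0 : (0 : ℝ) ≤ max t 0 := le_max_right _ _
    rw [dist_eq_norm, hT, hT, ← smul_sub, add_sub_add_left_eq_sub,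
      ← intervalIntegral.integral_sub ((hvz z).intervalIntegrable _ _)
        ((hvz w).intervalIntegrable _ _)]
    apply hdiv
    refine hbd _ _ ?_ (by positivity) _ h0
    intro σ hσ
    refine (hlip _ _ _).trans ?_
    rw [← smul_sub, norm_smul, Real.norm_eq_abs, abs_of_pos (Real.exp_pos _)]
    have h1 : ‖z σ - w σ‖ ≤ dist z w := by
      rw [← dist_eq_norm]; exact BoundedContinuousFunction.dist_coe_le_dist σ
    have h5 := hK0 σ
    have h6 : K σ * (Real.exp (l σ) * ‖z σ - w σ‖) ≤ K σ * (Real.exp (l σ) * dist z w) := by gcongr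
    have h10 : 0 ≤ dist z w * (Real.exp (l σ) * ‖v σ 0‖) := by positivity
    simp only [hΛ]
    push_cast
    linarith
  set z := hcontr.fixedPoint T with hz
  have hfix : T z = z := hcontr.fixedPoint_isFixedPt
  refine ⟨fun t => y₀ + ∫ σ in (0 : ℝ)..t, v σ (Real.exp (l σ) • z σ), by simp, fun t ht => ?_⟩
  have h1 : Real.exp (l t) • z t = y₀ + ∫ σ in (0 : ℝ)..t, v σ (Real.exp (l σ) • z σ) := by
    conv_lhs => rw [← hfix, hT, max_eq_left ht, smul_smul, ← Real.exp_add]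
    simp
  have h2 := ((hvz z).integral_hasStrictDerivAt 0 t).hasDerivAt.const_add y₀
  rwa [h1] at h2

/-- Two solutions of an equation whose right-hand side is Lipschitz in the state,
uniformly on bounded sets of times and states, agree on `[0, ∞)`. -/
theorem eqOn_of_solutions {G : Type*} [NormedAddCommGroup G] [NormedSpace ℝ G]
    (v : ℝ → G → G)
    (hlip : ∀ T ρ : ℝ, ∃ L : NNReal, ∀ t ∈ Icc 0 T, LipschitzOnWith L (v t) (Metric.closedBall 0 ρ))
    (y z : ℝ → G) (hy : ∀ t ∈ Ici (0 : ℝ), HasDerivWithinAt y (v t (y t)) (Ici 0) t)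
    (hz : ∀ t ∈ Ici (0 : ℝ), HasDerivWithinAt z (v t (z t)) (Ici 0) t) (h0 : y 0 = z 0) :
    EqOn y z (Ici 0) := by
  intro T hT
  have hyc : ContinuousOn y (Icc 0 T) := fun t ht =>
    ((hy t ht.1).continuousWithinAt).mono Icc_subset_Ici_self
  have hzc : ContinuousOn z (Icc 0 T) := fun t ht =>
    ((hz t ht.1).continuousWithinAt).mono Icc_subset_Ici_self
  obtain ⟨a, ha⟩ := isCompact_Icc.exists_bound_of_continuousOn hyc
  obtain ⟨b, hb⟩ := isCompact_Icc.exists_bound_of_continuousOn hzc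
  obtain ⟨L, hL⟩ := hlip T (max a b)
  refine ODE_solution_unique_of_mem_Icc_right (v := v)
    (s := fun _ => Metric.closedBall 0 (max a b)) (K := L)
    (fun t ht => hL t ⟨ht.1, ht.2.le⟩) hyc
    (fun t ht => (hy t ht.1).mono (Ici_subset_Ici.2 ht.1))
    (fun t ht => ?_) hzc
    (fun t ht => (hz t ht.1).mono (Ici_subset_Ici.2 ht.1))
    (fun t ht => ?_) h0 ⟨hT, le_rfl⟩
  · rw [mem_closedBall_zero_iff]
    exact (ha t ⟨ht.1, ht.2.le⟩).trans (le_max_left _ _)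
  · rw [mem_closedBall_zero_iff]
    exact (hb t ⟨ht.1, ht.2.le⟩).trans (le_max_right _ _)

end

/-! ### The weights of the Gramian -/

section

/-- A continuous positive function that is homogeneous of degree two dominates a multiple of the
square of the norm. -/
theorem exists_pos_mul_sq_norm_le {G : Type*} [NormedAddCommGroup G] [NormedSpace ℝ G]
    [FiniteDimensional ℝ G] (q : G → ℝ) (hq : Continuous q)
    (hhom : ∀ (c : ℝ) x, q (c • x) = c ^ 2 * q x) (hpos : ∀ x, x ≠ 0 → 0 < q x) :
    ∃ c > 0, ∀ x, c * ‖x‖ ^ 2 ≤ q x := by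
  have := FiniteDimensional.proper ℝ G
  have hq0 : q 0 = 0 := by simpa using hhom 0 0
  rcases (Metric.sphere (0 : G) 1).eq_empty_or_nonempty with h | h
  · refine ⟨1, one_pos, fun x => ?_⟩
    have hx : x = 0 := by
      by_contra hx
      have : ‖x‖⁻¹ • x ∈ Metric.sphere (0 : G) 1 := by
        simp [norm_smul, hx]
      simp [h] at this
    simp [hx, hq0]
  · obtain ⟨x₀, hx₀, hmin⟩ := (isCompact_sphere (0 : G) 1).exists_isMinOn h hq.continuousOn
    have hx₀0 : x₀ ≠ 0 := by rintro rfl; simp at hx₀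
    refine ⟨q x₀, hpos _ hx₀0, fun x => ?_⟩
    by_cases hx : x = 0
    · simp [hx, hq0]
    have h1 : q x₀ ≤ q (‖x‖⁻¹ • x) := hmin (by simp [norm_smul, hx])
    rw [hhom, inv_pow, ← div_eq_inv_mul, le_div_iff₀ (by positivity)] at h1
    exact h1

/-- The divided power `(θ - 1)^k / k!`. -/
def divPow (k : ℕ) (θ : ℝ) : ℝ := (θ - 1) ^ k / (k.factorial : ℝ)

/-- The weight matrix of the Gramian: the Gram matrix of the divided powers for the measure
`θ^m dθ` on `[0, 1]`. -/
def weight (m j k : ℕ) : ℝ := ∫ θ in (0 : ℝ)..1, θ ^ m * (divPow j θ * divPow k θ)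

@[fun_prop]
theorem continuous_divPow (k : ℕ) : Continuous (divPow k) := by
  unfold divPow; fun_prop

theorem weight_comm (m j k : ℕ) : weight m j k = weight m k j := by
  simp only [weight, mul_comm (divPow j _)]

theorem abs_weight_le_one (m j k : ℕ) : |weight m j k| ≤ 1 := by
  have hq : ∀ k, ∀ θ ∈ Ioc (0 : ℝ) 1, |divPow k θ| ≤ 1 := by
    intro k θ hθ
    rw [divPow, abs_div, abs_pow, Nat.abs_cast, div_le_one (by positivity)]
    calc |θ - 1| ^ k ≤ 1 := pow_le_one₀ (abs_nonneg _)
            (by rw [abs_le]; constructor <;> linarith [hθ.1, hθ.2])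
      _ ≤ k.factorial := by exact_mod_cast k.factorial_pos
  have := intervalIntegral.norm_integral_le_of_norm_le_const (a := (0 : ℝ)) (b := 1) (C := 1)
    (f := fun θ => θ ^ m * (divPow j θ * divPow k θ)) (by
      intro θ hθ
      rw [uIoc_of_le zero_le_one] at hθ
      rw [Real.norm_eq_abs, abs_mul, abs_mul, abs_pow]
      have h1 : |θ| ^ m ≤ 1 := pow_le_one₀ (abs_nonneg _) (by rw [abs_of_pos hθ.1]; exact hθ.2)
      have h2 := mul_le_one₀ (hq j θ hθ) (abs_nonneg _) (hq k θ hθ)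
      exact mul_le_one₀ h1 (by positivity) h2)
  simpa [weight] using this

/-- `θ` times the derivative of a divided power. -/
def eulerDivPow : ℕ → ℝ → ℝ
  | 0 => fun _ => 0
  | k + 1 => fun θ => (k + 1) * divPow (k + 1) θ + divPow k θ

theorem hasDerivAt_divPow (k : ℕ) (θ : ℝ) :
    ∃ q' : ℝ, HasDerivAt (divPow k) q' θ ∧ θ * q' = eulerDivPow k θ := by
  cases k with
  | zero =>
    have h : divPow 0 = fun _ => 1 := by ext; simp [divPow]
    exact ⟨0, by rw [h]; exact hasDerivAt_const θ 1, by simp [eulerDivPow]⟩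
  | succ k =>
    refine ⟨divPow k θ, ?_, ?_⟩
    · have := (((hasDerivAt_id θ).sub_const 1).pow (k + 1)).div_const ((k + 1).factorial : ℝ)
      refine this.congr_deriv ?_
      simp only [divPow, Nat.factorial_succ, id]
      push_cast
      field_simp
    · simp only [eulerDivPow, divPow, Nat.factorial_succ]
      push_cast
      field_simp
      ring

/-- The weight with the first index lowered by one; it is zero if that index is zero. -/
def weightPred (m : ℕ) : ℕ → ℕ → ℝ
  | 0, _ => 0
  | j + 1, k => weight m j k

theorem integral_mul_eulerDivPow (m j k : ℕ) :
    ∫ θ in (0 : ℝ)..1, θ ^ m * (eulerDivPow j θ * divPow k θ)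
      = j * weight m j k + weightPred m j k := by
  cases j with
  | zero => simp [eulerDivPow, weightPred]
  | succ j =>
    simp only [eulerDivPow, weightPred, weight]
    rw [← intervalIntegral.integral_const_mul, ← intervalIntegral.integral_add]
    · congr 1; ext θ; push_cast; ring
    all_goals exact Continuous.intervalIntegrable (by fun_prop) _ _

@[fun_prop]
theorem continuous_eulerDivPow (k : ℕ) : Continuous (eulerDivPow k) := by
  cases k <;> (unfold eulerDivPow; fun_prop)

/-- The discrete Lyapunov equation of the weights; it is an integration by parts of
`d/dθ (θ^(m+1) q_j q_k)`. -/
theorem weight_recurrence (m j k : ℕ) :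
    (m + 1 + j + k) * weight m j k + weightPred m j k + weightPred m k j
      = if j = 0 ∧ k = 0 then 1 else 0 := by
  have hd : ∀ θ : ℝ, HasDerivAt (fun θ : ℝ => θ ^ (m + 1) * (divPow j θ * divPow k θ))
      ((m + 1) * (θ ^ m * (divPow j θ * divPow k θ))
        + θ ^ m * (eulerDivPow j θ * divPow k θ) + θ ^ m * (eulerDivPow k θ * divPow j θ)) θ := by
    intro θ
    obtain ⟨a, ha, ha'⟩ := hasDerivAt_divPow j θ
    obtain ⟨b, hb, hb'⟩ := hasDerivAt_divPow k θ
    refine ((hasDerivAt_pow (m + 1) θ).mul (ha.mul hb)).congr_deriv ?_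
    rw [← ha', ← hb']
    push_cast
    simp only [Pi.mul_apply]
    ring
  have h := intervalIntegral.integral_eq_sub_of_hasDerivAt (a := 0) (b := 1) (fun θ _ => hd θ)
    (Continuous.intervalIntegrable (by fun_prop) _ _)
  rw [intervalIntegral.integral_add (Continuous.intervalIntegrable (by fun_prop) _ _)
      (Continuous.intervalIntegrable (by fun_prop) _ _),
    intervalIntegral.integral_add (Continuous.intervalIntegrable (by fun_prop) _ _)
      (Continuous.intervalIntegrable (by fun_prop) _ _),
    intervalIntegral.integral_const_mul, integral_mul_eulerDivPow, integral_mul_eulerDivPow] at h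
  rw [weight_comm m k j] at h
  rw [show (∫ θ in (0 : ℝ)..1, θ ^ m * (divPow j θ * divPow k θ)) = weight m j k from rfl] at h
  have hR : (1 : ℝ) ^ (m + 1) * (divPow j 1 * divPow k 1) - 0 ^ (m + 1) * (divPow j 0 * divPow k 0)
      = if j = 0 ∧ k = 0 then 1 else 0 := by
    rcases j with _ | j <;> rcases k with _ | k <;> simp [divPow]
  rw [← hR, ← h]
  ring

/-- The divided powers are linearly independent on `(0, 1)`, so the weights are positive definite. -/
theorem sum_weight_pos (m n : ℕ) (v : Fin n → ℝ) (hv : v ≠ 0) :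
    0 < ∑ j : Fin n, ∑ k : Fin n, weight m j k * (v j * v k) := by
  have h1 : ∑ j : Fin n, ∑ k : Fin n, weight m j k * (v j * v k)
      = ∫ θ in (0 : ℝ)..1, θ ^ m * (∑ k, v k * divPow k θ) ^ 2 := by
    simp_rw [weight, ← intervalIntegral.integral_mul_const]
    simp_rw [pow_two (∑ k, v k * divPow k _), Finset.sum_mul_sum, Finset.mul_sum]
    rw [intervalIntegral.integral_finsetSum]
    · refine Finset.sum_congr rfl fun j _ => ?_
      rw [intervalIntegral.integral_finsetSum]
      · refine Finset.sum_congr rfl fun k _ => ?_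
        congr 1; ext θ; ring
      · intro k _; exact Continuous.intervalIntegrable (by fun_prop) _ _
    · intro k _; exact Continuous.intervalIntegrable (by fun_prop) _ _
  rw [h1]
  -- the combination of divided powers is a nonzero polynomial
  let p : Polynomial ℝ := ∑ k : Fin n, Polynomial.monomial k (v k / ((k : ℕ).factorial : ℝ))
  have hp : p ≠ 0 := by
    intro h
    apply hv
    ext i
    have := congrArg (fun q => Polynomial.coeff q (i : ℕ)) h
    simp only [p, Polynomial.finsetSum_coeff, Polynomial.coeff_monomial, Fin.val_inj,
      Finset.sum_ite_eq', Finset.mem_univ, if_true, Polynomial.coeff_zero] at this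
    simpa [Nat.factorial_ne_zero] using this
  have hpe : ∀ θ, ∑ k, v k * divPow k θ = p.eval (θ - 1) := by
    intro θ
    simp only [p, Polynomial.eval_finsetSum, Polynomial.eval_monomial, divPow]
    exact Finset.sum_congr rfl fun k _ => by ring
  have hne : ∃ θ ∈ Ioo (0 : ℝ) 1, ∑ k, v k * divPow k θ ≠ 0 := by
    by_contra! hcon
    have hinf : (Ioo (-1 : ℝ) 0).Infinite := Ioo_infinite (by norm_num)
    apply hp
    refine Polynomial.eq_zero_of_infinite_isRoot p (hinf.mono fun x hx => ?_)
    have := hcon (x + 1) ⟨by linarith [hx.1], by linarith [hx.2]⟩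
    rw [hpe] at this
    simpa using this
  obtain ⟨θ, hθ, hθ'⟩ := hne
  have hc : Continuous fun θ : ℝ => θ ^ m * (∑ k : Fin n, v k * divPow k θ) ^ 2 := by fun_prop
  refine intervalIntegral.integral_pos one_pos hc.continuousOn
    (fun x hx => by have := hx.1; positivity) ⟨θ, ⟨hθ.1.le, hθ.2.le⟩, ?_⟩
  have := hθ.1
  positivity

/-- Positive definiteness of the weights for families of vectors. -/
theorem exists_pos_mul_sum_sq_norm_le (m n r : ℕ) :
    ∃ z > 0, ∀ v : ℕ → Vec r, z * ∑ k ∈ Finset.range n, ‖v k‖ ^ 2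
      ≤ ∑ j ∈ Finset.range n, ∑ k ∈ Finset.range n, weight m j k * inner ℝ (v j) (v k) := by
  obtain ⟨z, hz, h⟩ := exists_pos_mul_sq_norm_le (G := EuclideanSpace ℝ (Fin n))
    (fun v => ∑ j : Fin n, ∑ k : Fin n, weight m j k * (v j * v k)) (by fun_prop)
    (fun c x => by
      simp only [PiLp.smul_apply, smul_eq_mul, Finset.mul_sum]
      refine Finset.sum_congr rfl fun j _ => Finset.sum_congr rfl fun k _ => by ring)
    (fun x hx => sum_weight_pos m n _ (fun h => hx (by ext i; exact congrFun h i)))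
  refine ⟨z, hz, fun v => ?_⟩
  have h1 : ∑ j ∈ Finset.range n, ∑ k ∈ Finset.range n, weight m j k * inner ℝ (v j) (v k)
      = ∑ i : Fin r, ∑ j : Fin n, ∑ k : Fin n, weight m j k * (v j i * v k i) := by
    symm
    rw [Finset.sum_comm, Finset.sum_range]
    refine Finset.sum_congr rfl fun j _ => ?_
    rw [Finset.sum_comm, Finset.sum_range]
    refine Finset.sum_congr rfl fun k _ => ?_
    rw [PiLp.inner_apply, Finset.mul_sum]
    refine Finset.sum_congr rfl fun i _ => ?_
    simp [mul_comm]
  have h2 : ∑ k ∈ Finset.range n, ‖v k‖ ^ 2 = ∑ i : Fin r, ∑ k : Fin n, (v k i) ^ 2 := by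
    symm
    rw [Finset.sum_comm, Finset.sum_range]
    refine Finset.sum_congr rfl fun k _ => ?_
    rw [EuclideanSpace.norm_sq_eq]
    simp
  rw [h1, h2, Finset.mul_sum]
  refine Finset.sum_le_sum fun i _ => ?_
  have := h (WithLp.toLp 2 fun k => v k i)
  rw [EuclideanSpace.norm_sq_eq] at this
  simpa using this

end

/-! ### The weighted Gramian -/

section

theorem sum_weight_shift (m n : ℕ) (G : ℕ → ℕ → ℝ) :
    ∑ j ∈ Finset.range (n + 1), ∑ k ∈ Finset.range (n + 1),
      weight m j k * ((m + 1 + j + k) * G j k + G (j + 1) k + G j (k + 1))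
    = G 0 0 + ∑ k ∈ Finset.range (n + 1), weight m n k * (G (n + 1) k + G k (n + 1)) := by
  have key : ∀ (g : ℕ → ℝ) (k : ℕ), ∑ j ∈ Finset.range (n + 1), weight m j k * g (j + 1)
      = ∑ j ∈ Finset.range (n + 1), weightPred m j k * g j + weight m n k * g (n + 1) := by
    intro g k
    have h1 := Finset.sum_range_succ (fun j => weightPred m j k * g j) (n + 1)
    have h2 := Finset.sum_range_succ' (fun j => weightPred m j k * g j) (n + 1)
    rw [h1] at h2
    simpa [weightPred] using h2.symm
  have e1 : ∑ j ∈ Finset.range (n + 1), ∑ k ∈ Finset.range (n + 1), weight m j k * G (j + 1) k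
      = ∑ j ∈ Finset.range (n + 1), ∑ k ∈ Finset.range (n + 1), weightPred m j k * G j k
        + ∑ k ∈ Finset.range (n + 1), weight m n k * G (n + 1) k := by
    rw [Finset.sum_comm, Finset.sum_comm (f := fun j k => weightPred m j k * G j k),
      ← Finset.sum_add_distrib]
    exact Finset.sum_congr rfl fun k _ => key (fun j => G j k) k
  have e2 : ∑ j ∈ Finset.range (n + 1), ∑ k ∈ Finset.range (n + 1), weight m j k * G j (k + 1)
      = ∑ j ∈ Finset.range (n + 1), ∑ k ∈ Finset.range (n + 1), weightPred m k j * G j k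
        + ∑ k ∈ Finset.range (n + 1), weight m n k * G k (n + 1) := by
    rw [← Finset.sum_add_distrib]
    refine Finset.sum_congr rfl fun j _ => ?_
    simp_rw [fun k => weight_comm m j k]
    exact key (fun k => G j k) j
  have e3 : ∑ j ∈ Finset.range (n + 1), ∑ k ∈ Finset.range (n + 1),
      ((m + 1 + j + k) * weight m j k + weightPred m j k + weightPred m k j) * G j k = G 0 0 := by
    simp_rw [weight_recurrence]
    rw [Finset.sum_range_succ', Finset.sum_range_succ']
    simp
  simp only [mul_add, add_mul, Finset.sum_add_distrib] at e1 e2 e3 ⊢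
  rw [e1, e2, ← e3]
  simp only [mul_assoc, mul_left_comm (weight _ _ _)]
  ring

variable {E : Type*} [NormedAddCommGroup E] [InnerProductSpace ℝ E] [CompleteSpace E] {r : ℕ}

open ContinuousLinearMap (adjoint)

/-- The weighted Gramian `∑ Z_jk s^(j+k+1) Q_j Q_k*`. -/
def gramian (m n : ℕ) (s : ℝ) (Q : ℕ → Vec r →L[ℝ] E) : E →L[ℝ] E :=
  ∑ j ∈ Finset.range n, ∑ k ∈ Finset.range n,
    (weight m j k * s ^ (j + k + 1)) • (Q j).comp (adjoint (Q k))

theorem inner_gramian (m n : ℕ) (s : ℝ) (Q : ℕ → Vec r →L[ℝ] E) (ζ η : E) :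
    inner ℝ ζ (gramian m n s Q η) = ∑ j ∈ Finset.range n, ∑ k ∈ Finset.range n,
      weight m j k * s ^ (j + k + 1) * inner ℝ (adjoint (Q j) ζ) (adjoint (Q k) η) := by
  simp only [gramian, sum_apply, smul_apply,
    ContinuousLinearMap.comp_apply, inner_sum, inner_smul_right,
    ContinuousLinearMap.adjoint_inner_left]

theorem inner_gramian_comm (m n : ℕ) (s : ℝ) (Q : ℕ → Vec r →L[ℝ] E) (ζ η : E) :
    inner ℝ ζ (gramian m n s Q η) = inner ℝ (gramian m n s Q ζ) η := by
  rw [real_inner_comm η, inner_gramian, inner_gramian, Finset.sum_comm]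
  refine Finset.sum_congr rfl fun j _ => Finset.sum_congr rfl fun k _ => ?_
  rw [weight_comm, real_inner_comm, add_comm k j]

/-- The energy `∑ s^(2k+1) ‖Q_k* η‖^2`, to which the quadratic form of the Gramian is
comparable. -/
def energy (n : ℕ) (s : ℝ) (Q : ℕ → Vec r →L[ℝ] E) (η : E) : ℝ :=
  ∑ k ∈ Finset.range n, s ^ (2 * k + 1) * ‖adjoint (Q k) η‖ ^ 2

theorem energy_nonneg (n : ℕ) {s : ℝ} (hs : 0 ≤ s) (Q : ℕ → Vec r →L[ℝ] E) (η : E) :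
    0 ≤ energy n s Q η := Finset.sum_nonneg fun k _ => by positivity

theorem mul_energy_le_inner_gramian {m n : ℕ} {z : ℝ}
    (hz : ∀ v : ℕ → Vec r, z * ∑ k ∈ Finset.range n, ‖v k‖ ^ 2
      ≤ ∑ j ∈ Finset.range n, ∑ k ∈ Finset.range n, weight m j k * inner ℝ (v j) (v k))
    {s : ℝ} (hs : 0 ≤ s) (Q : ℕ → Vec r →L[ℝ] E) (η : E) :
    z * energy n s Q η ≤ inner ℝ η (gramian m n s Q η) := by
  have h := mul_le_mul_of_nonneg_left (hz fun k => s ^ k • adjoint (Q k) η) hs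
  rw [inner_gramian, energy]
  refine (le_of_eq ?_).trans (h.trans (le_of_eq ?_))
  · rw [mul_left_comm]
    congr 1
    rw [Finset.mul_sum]
    refine Finset.sum_congr rfl fun k _ => ?_
    rw [norm_smul, norm_pow, Real.norm_eq_abs, abs_of_nonneg hs]
    ring
  · simp_rw [Finset.mul_sum]
    refine Finset.sum_congr rfl fun j _ => Finset.sum_congr rfl fun k _ => ?_
    rw [real_inner_smul_left, real_inner_smul_right]
    ring

theorem sq_sum_mul_norm_le (n : ℕ) (s : ℝ) (Q : ℕ → Vec r →L[ℝ] E) (η : E) :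
    (∑ k ∈ Finset.range n, s ^ (k + 1) * ‖adjoint (Q k) η‖) ^ 2 ≤ n * s * energy n s Q η := by
  have h := sq_sum_le_card_mul_sum_sq (s := Finset.range n)
    (f := fun k => s ^ (k + 1) * ‖adjoint (Q k) η‖)
  refine h.trans (le_of_eq ?_)
  rw [Finset.card_range, energy, mul_assoc]
  congr 1
  rw [Finset.mul_sum]
  exact Finset.sum_congr rfl fun k _ => by ring

theorem sq_norm_gramian_le {m n : ℕ} {s b : ℝ} (hs : 0 ≤ s) (hs1 : s ≤ 1)
    (Q : ℕ → Vec r →L[ℝ] E) (hQ : ∀ k, k ≤ n → ‖Q k‖ ≤ b) (η : E) :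
    ‖gramian m n s Q η‖ ^ 2 ≤ (n ^ 3 * b ^ 2) * s * energy n s Q η := by
  have h1 : ‖gramian m n s Q η‖
      ≤ n * b * ∑ k ∈ Finset.range n, s ^ (k + 1) * ‖adjoint (Q k) η‖ := by
    simp only [gramian, sum_apply, smul_apply,
      ContinuousLinearMap.comp_apply]
    refine (norm_sum_le _ _).trans ?_
    rw [mul_assoc, ← nsmul_eq_mul, ← Finset.card_range n, ← Finset.sum_const, Finset.card_range]
    refine Finset.sum_le_sum fun j hj => ?_
    refine (norm_sum_le _ _).trans ?_
    rw [Finset.mul_sum]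
    refine Finset.sum_le_sum fun k _ => ?_
    rw [norm_smul, norm_mul, norm_pow, Real.norm_eq_abs, Real.norm_eq_abs, abs_of_nonneg hs]
    have e1 := (Q j).le_opNorm (adjoint (Q k) η)
    have e2 := hQ j (Finset.mem_range.1 hj).le
    have e3 : s ^ (j + k + 1) ≤ s ^ (k + 1) := pow_le_pow_of_le_one hs hs1 (by omega)
    calc |weight m j k| * s ^ (j + k + 1) * ‖Q j (adjoint (Q k) η)‖
        ≤ 1 * s ^ (k + 1) * (b * ‖adjoint (Q k) η‖) := by
          gcongr
          · exact abs_weight_le_one m j k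
          · exact e1.trans (by gcongr)
      _ = _ := by ring
  have h0 : 0 ≤ ∑ k ∈ Finset.range n, s ^ (k + 1) * ‖adjoint (Q k) η‖ :=
    Finset.sum_nonneg fun k _ => by positivity
  calc ‖gramian m n s Q η‖ ^ 2
      ≤ (n * b * ∑ k ∈ Finset.range n, s ^ (k + 1) * ‖adjoint (Q k) η‖) ^ 2 := by gcongr
    _ = (n * b) ^ 2 * (∑ k ∈ Finset.range n, s ^ (k + 1) * ‖adjoint (Q k) η‖) ^ 2 := by ring
    _ ≤ (n * b) ^ 2 * (n * s * energy n s Q η) := by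
        gcongr
        exact sq_sum_mul_norm_le n s Q η
    _ = _ := by ring

/-- The derivative of the Gramian along a sequence with `Q_k' = Q_(k+1) - P Q_k`. -/
def gramianDeriv (m n : ℕ) (s : ℝ) (P : E →L[ℝ] E) (Q : ℕ → Vec r →L[ℝ] E) : E →L[ℝ] E :=
  ∑ j ∈ Finset.range n, ∑ k ∈ Finset.range n,
    ((weight m j k * ((j + k + 1) * s ^ (j + k))) • (Q j).comp (adjoint (Q k))
      + (weight m j k * s ^ (j + k + 1)) • ((Q (j + 1) - P.comp (Q j)).comp (adjoint (Q k))
          + (Q j).comp (adjoint (Q (k + 1) - P.comp (Q k)))))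

theorem inner_gramianDeriv (m n : ℕ) {s : ℝ} (hs : s ≠ 0) (P : E →L[ℝ] E)
    (Q : ℕ → Vec r →L[ℝ] E) (η : E) :
    inner ℝ η (gramianDeriv m (n + 1) s P Q η) + 2 * inner ℝ η (P (gramian m (n + 1) s Q η))
        + m / s * inner ℝ η (gramian m (n + 1) s Q η)
      = ‖adjoint (Q 0) η‖ ^ 2 + 2 * ∑ k ∈ Finset.range (n + 1), weight m n k *
          (s ^ (n + 1 + k) * inner ℝ (adjoint (Q (n + 1)) η) (adjoint (Q k) η)) := by
  set G : ℕ → ℕ → ℝ := fun j k =>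
    s ^ (j + k) * inner ℝ (adjoint (Q j) η) (adjoint (Q k) η) with hG
  have hGc : ∀ j k, G j k = G k j := fun j k => by
    simp only [hG]; rw [add_comm, real_inner_comm]
  set H : ℕ → ℕ → ℝ := fun j k =>
    weight m j k * s ^ (j + k + 1) * inner ℝ (adjoint P η) (Q j (adjoint (Q k) η)) with hH
  have h1 : inner ℝ η (gramianDeriv m (n + 1) s P Q η)
      = ∑ j ∈ Finset.range (n + 1), ∑ k ∈ Finset.range (n + 1),
        (weight m j k * ((1 + j + k) * G j k + G (j + 1) k + G j (k + 1)) - H j k - H k j) := by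
    simp only [gramianDeriv, sum_apply, inner_sum]
    refine Finset.sum_congr rfl fun j _ => Finset.sum_congr rfl fun k _ => ?_
    simp only [smul_apply, add_apply,
      sub_apply, map_sub, ContinuousLinearMap.adjoint_comp,
      ContinuousLinearMap.comp_apply, inner_add_right, inner_sub_right, inner_smul_right,
      hG, hH, ContinuousLinearMap.adjoint_inner_left]
    rw [weight_comm m k j, add_comm k j]
    have e1 : ∀ (j : ℕ) (v : Vec r), inner ℝ η (Q j v) = inner ℝ (adjoint (Q j) η) v :=
      fun j v => (ContinuousLinearMap.adjoint_inner_left _ _ _).symm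
    have e2 : inner ℝ η (Q j (adjoint (Q k) (adjoint P η)))
        = inner ℝ η (P (Q k (adjoint (Q j) η))) := by
      rw [e1, ContinuousLinearMap.adjoint_inner_right, real_inner_comm,
        ContinuousLinearMap.adjoint_inner_left]
    rw [e2]
    simp only [e1]
    ring
  have h2 : inner ℝ η (P (gramian m (n + 1) s Q η))
      = ∑ j ∈ Finset.range (n + 1), ∑ k ∈ Finset.range (n + 1), H j k := by
    rw [← ContinuousLinearMap.adjoint_inner_left, gramian]
    simp only [sum_apply, inner_sum, smul_apply,
      ContinuousLinearMap.comp_apply, inner_smul_right, hH]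
  have h3 : m / s * inner ℝ η (gramian m (n + 1) s Q η)
      = ∑ j ∈ Finset.range (n + 1), ∑ k ∈ Finset.range (n + 1), weight m j k * (m * G j k) := by
    rw [inner_gramian]
    simp_rw [Finset.mul_sum]
    refine Finset.sum_congr rfl fun j _ => Finset.sum_congr rfl fun k _ => ?_
    simp only [hG]
    field_simp
    ring
  have h4 := sum_weight_shift m n G
  have h5 : ∑ j ∈ Finset.range (n + 1), ∑ k ∈ Finset.range (n + 1), H k j
      = ∑ j ∈ Finset.range (n + 1), ∑ k ∈ Finset.range (n + 1), H j k := Finset.sum_comm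
  have h6 : G 0 0 = ‖adjoint (Q 0) η‖ ^ 2 := by simp [hG]
  have h7 : 2 * ∑ k ∈ Finset.range (n + 1), weight m n k *
          (s ^ (n + 1 + k) * inner ℝ (adjoint (Q (n + 1)) η) (adjoint (Q k) η))
      = ∑ k ∈ Finset.range (n + 1), weight m n k * (G (n + 1) k + G k (n + 1)) := by
    rw [Finset.mul_sum]
    refine Finset.sum_congr rfl fun k _ => ?_
    rw [hGc k (n + 1)]; simp only [hG]; ring
  rw [h7, ← h6, ← h4, h1, h2, h3]
  simp only [Finset.sum_sub_distrib, h5, mul_add, add_mul, Finset.sum_add_distrib]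
  ring

end

/-! ### The Lyapunov inequality -/

section

variable {E : Type*} [NormedAddCommGroup E] [InnerProductSpace ℝ E] [CompleteSpace E] {r : ℕ}

open ContinuousLinearMap (adjoint)

theorem hasDerivAt_adjoint {Q : ℝ → Vec r →L[ℝ] E} {Q' : Vec r →L[ℝ] E} {s : ℝ}
    (h : HasDerivAt Q Q' s) : HasDerivAt (fun s => adjoint (Q s)) (adjoint Q') s := by
  -- over `ℝ` the adjoint is linear, not only conjugate-linear
  let T : (Vec r →L[ℝ] E) →L[ℝ] (E →L[ℝ] Vec r) :=
    LinearMap.mkContinuous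
      { toFun := fun A => adjoint A
        map_add' := fun A B => map_add _ A B
        map_smul' := fun c A => by simp } 1 (fun A => by simp)
  exact T.hasFDerivAt.comp_hasDerivAt s h

theorem hasDerivAt_gramian (m n : ℕ) (P : ℝ → E →L[ℝ] E) (Q : ℕ → ℝ → Vec r →L[ℝ] E) (s : ℝ)
    (hQ : ∀ k, HasDerivAt (Q k) (Q (k + 1) s - (P s).comp (Q k s)) s) :
    HasDerivAt (fun s => gramian m n s fun k => Q k s)
      (gramianDeriv m n s (P s) fun k => Q k s) s := by
  unfold gramian gramianDeriv
  refine HasDerivAt.fun_sum fun j _ => HasDerivAt.fun_sum fun k _ => ?_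
  have h1 := (hQ j).clm_comp (hasDerivAt_adjoint (hQ k))
  have h2 := (hasDerivAt_pow (j + k + 1) s).const_mul (weight m j k)
  refine (h2.smul h1).congr_deriv ?_
  push_cast
  rw [add_comm]

/-- `W` is a symmetric matrix function with the Lyapunov inequality for `dc/ds = -(P c + Q d)`:
in the variable `η = W⁻¹ c`, the quadratic form `⟪c, W⁻¹ c⟫` decays like `s^m` as `s → 0` under
the feedback `d = -Q* W⁻¹ c / 2`. The constants `c` and `C` of the structure bound the form from
below, with the factor `s^(2n+1)`, and the operator from above, with the factor `s`. The length of
the controllability sequence is `n + 1`. -/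
structure IsGramian (m n : ℕ) (c C : ℝ) (P : ℝ → E →L[ℝ] E) (Q : ℝ → Vec r →L[ℝ] E)
    (W W' : ℝ → E →L[ℝ] E) : Prop where
  hasDerivAt : ∀ s, HasDerivAt W (W' s) s
  symm : ∀ s ζ η, inner ℝ ζ (W s η) = inner ℝ (W s ζ) η
  lower : ∀ s ∈ Ioc (0 : ℝ) 1, ∀ η, c * s ^ (2 * n + 1) * ‖η‖ ^ 2 ≤ inner ℝ η (W s η)
  upper : ∀ s ∈ Ioc (0 : ℝ) 1, ∀ η, ‖W s η‖ ^ 2 ≤ C * s * inner ℝ η (W s η)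
  lyapunov : ∀ s ∈ Ioc (0 : ℝ) 1, ∀ η,
    inner ℝ η (W' s η) + 2 * inner ℝ η (P s (W s η)) + m / s * inner ℝ η (W s η)
      ≤ ‖adjoint (Q s) η‖ ^ 2

theorem pow_mul_sq_norm_le_energy {n : ℕ} {s c : ℝ} (hs : s ∈ Ioc (0 : ℝ) 1)
    (Q : ℕ → Vec r →L[ℝ] E) (η : E)
    (hc : c * ‖η‖ ^ 2 ≤ ∑ k ∈ Finset.range (n + 1), ‖adjoint (Q k) η‖ ^ 2) :
    c * s ^ (2 * n + 1) * ‖η‖ ^ 2 ≤ energy (n + 1) s Q η := by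
  have h0 := hs.1
  calc c * s ^ (2 * n + 1) * ‖η‖ ^ 2 = s ^ (2 * n + 1) * (c * ‖η‖ ^ 2) := by ring
    _ ≤ s ^ (2 * n + 1) * ∑ k ∈ Finset.range (n + 1), ‖adjoint (Q k) η‖ ^ 2 := by gcongr
    _ ≤ energy (n + 1) s Q η := by
        rw [Finset.mul_sum, energy]
        refine Finset.sum_le_sum fun k hk => ?_
        have : k ≤ n := by have := Finset.mem_range.1 hk; omega
        gcongr ?_ * _
        exact pow_le_pow_of_le_one h0.le hs.2 (by omega)

/-- The boundary term of the Lyapunov equation is of lower order: it is bounded by the energy. -/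
theorem boundary_le_energy {m n : ℕ} {s c b : ℝ} (hs : s ∈ Ioc (0 : ℝ) 1) (hc0 : 0 < c)
    (Q : ℕ → Vec r →L[ℝ] E) (hQ : ‖Q (n + 1)‖ ≤ b) (η : E)
    (hc : c * ‖η‖ ^ 2 ≤ ∑ k ∈ Finset.range (n + 1), ‖adjoint (Q k) η‖ ^ 2) :
    2 * ∑ k ∈ Finset.range (n + 1), weight m n k *
        (s ^ (n + 1 + k) * inner ℝ (adjoint (Q (n + 1)) η) (adjoint (Q k) η))
      ≤ (b ^ 2 / c + (n + 1)) * energy (n + 1) s Q η := by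
  have h0 := hs.1
  set X := ‖adjoint (Q (n + 1)) η‖ with hX
  set Y := ∑ k ∈ Finset.range (n + 1), s ^ (k + 1) * ‖adjoint (Q k) η‖ with hY
  set S := energy (n + 1) s Q η with hS
  have h1 : ∑ k ∈ Finset.range (n + 1), weight m n k *
        (s ^ (n + 1 + k) * inner ℝ (adjoint (Q (n + 1)) η) (adjoint (Q k) η)) ≤ s ^ n * X * Y := by
    rw [hY, Finset.mul_sum]
    refine Finset.sum_le_sum fun k _ => ?_
    refine (le_abs_self _).trans ?_
    rw [abs_mul, abs_mul, abs_of_nonneg (by positivity : 0 ≤ s ^ (n + 1 + k))]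
    calc _ ≤ 1 * (s ^ (n + 1 + k) * (X * ‖adjoint (Q k) η‖)) := by
          gcongr
          · exact abs_weight_le_one m n k
          · exact abs_real_inner_le_norm _ _
      _ = _ := by ring
  have h2 : Y ^ 2 ≤ (n + 1) * s * S := by
    have := sq_sum_mul_norm_le (n + 1) s Q η
    push_cast at this
    exact this
  have h3 : X ^ 2 ≤ b ^ 2 * ‖η‖ ^ 2 := by
    rw [← mul_pow]
    have : X ≤ b * ‖η‖ := ((adjoint (Q (n + 1))).le_opNorm η).trans (by
      rw [LinearIsometryEquiv.norm_map]; gcongr)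
    gcongr
  have h4 := pow_mul_sq_norm_le_energy hs Q η hc
  have h5 : s ^ (2 * n + 1) * X ^ 2 ≤ b ^ 2 / c * S := by
    rw [div_mul_eq_mul_div, le_div_iff₀ hc0]
    calc s ^ (2 * n + 1) * X ^ 2 * c ≤ s ^ (2 * n + 1) * (b ^ 2 * ‖η‖ ^ 2) * c := by gcongr
      _ = b ^ 2 * (c * s ^ (2 * n + 1) * ‖η‖ ^ 2) := by ring
      _ ≤ _ := by gcongr
  have h6 : 2 * (s ^ n * X * Y) ≤ s ^ (2 * n + 1) * X ^ 2 + Y ^ 2 / s := by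
    have : s * (2 * (s ^ n * X * Y)) ≤ s * (s ^ (2 * n + 1) * X ^ 2 + Y ^ 2 / s) := by
      have e : s * (s ^ (2 * n + 1) * X ^ 2 + Y ^ 2 / s) = (s ^ (n + 1) * X) ^ 2 + Y ^ 2 := by
        field_simp; ring
      rw [e]
      have := two_mul_le_add_sq (s ^ (n + 1) * X) Y
      calc _ = 2 * (s ^ (n + 1) * X) * Y := by ring
        _ ≤ _ := this
    exact le_of_mul_le_mul_left this h0
  have h7 : Y ^ 2 / s ≤ (n + 1) * S := by
    rw [div_le_iff₀ h0]; linarith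
  linarith

/-- Boundedness and uniform controllability give a Gramian, with constants that depend only on
the bounds. -/
theorem exists_isGramian (m n : ℕ) {c₀ b : ℝ} (hc₀ : 0 < c₀) :
    ∃ c > 0, ∃ C > 0, ∀ (P : ℝ → E →L[ℝ] E) (Q : ℕ → ℝ → Vec r →L[ℝ] E),
      (∀ k s, HasDerivAt (Q k) (Q (k + 1) s - (P s).comp (Q k s)) s) →
      (∀ s ∈ Ioc (0 : ℝ) 1, ∀ k ≤ n + 1, ‖Q k s‖ ≤ b) →
      (∀ s ∈ Ioc (0 : ℝ) 1, ∀ η,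
        c₀ * ‖η‖ ^ 2 ≤ ∑ k ∈ Finset.range (n + 1), ‖adjoint (Q k s) η‖ ^ 2) →
      ∃ W W' : ℝ → E →L[ℝ] E, IsGramian m n c C P (Q 0) W W' := by
  obtain ⟨z, hz, hzv⟩ := exists_pos_mul_sum_sq_norm_le m (n + 1) r
  set A := b ^ 2 / c₀ + (n + 1) with hA
  have hA0 : 0 ≤ A := by positivity
  set D : ℝ := ((n + 1 : ℕ) : ℝ) ^ 3 * b ^ 2 with hD
  have hD0 : 0 ≤ D := by positivity
  set L := A / z with hL
  have hL0 : 0 ≤ L := by positivity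
  refine ⟨Real.exp (-L) * (z * c₀), by positivity, D / z + 1, by positivity,
    fun P Q hd hb hc => ?_⟩
  set G : ℝ → E →L[ℝ] E := fun s => gramian m (n + 1) s fun k => Q k s with hG
  set G' : ℝ → E →L[ℝ] E := fun s => gramianDeriv m (n + 1) s (P s) fun k => Q k s with hG'
  set S : ℝ → E → ℝ := fun s η => energy (n + 1) s (fun k => Q k s) η with hS
  have hexp : ∀ s, HasDerivAt (fun s => Real.exp (-L * s)) (-L * Real.exp (-L * s)) s := by
    intro s
    have := ((hasDerivAt_id s).const_mul (-L)).exp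
    simpa [mul_comm] using this
  have hzS : ∀ s ∈ Ioc (0 : ℝ) 1, ∀ η, z * S s η ≤ inner ℝ η (G s η) := fun s hs η =>
    mul_energy_le_inner_gramian hzv hs.1.le _ η
  have hS0 : ∀ s ∈ Ioc (0 : ℝ) 1, ∀ η, 0 ≤ S s η := fun s hs η =>
    energy_nonneg _ hs.1.le _ η
  have he1 : ∀ s ∈ Ioc (0 : ℝ) 1, Real.exp (-L * s) ≤ 1 := fun s hs => by
    rw [Real.exp_le_one_iff]; nlinarith [hs.1]
  have he2 : ∀ s ∈ Ioc (0 : ℝ) 1, Real.exp (-L) ≤ Real.exp (-L * s) := fun s hs => by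
    rw [Real.exp_le_exp]; nlinarith [hs.2]
  refine ⟨fun s => Real.exp (-L * s) • G s,
    fun s => Real.exp (-L * s) • G' s + (-L * Real.exp (-L * s)) • G s, ⟨?_, ?_, ?_, ?_, ?_⟩⟩
  · intro s
    exact (hexp s).smul (hasDerivAt_gramian m (n + 1) P Q s fun k => hd k s)
  · intro s ζ η
    simp only [smul_apply, inner_smul_right, real_inner_smul_left]
    rw [hG, inner_gramian_comm]
  · intro s hs η
    have h1 := pow_mul_sq_norm_le_energy hs (fun k => Q k s) η (hc s hs η)
    simp only [smul_apply, inner_smul_right]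
    have h2 := hzS s hs η
    have h0 := hs.1
    have h3 : 0 ≤ c₀ * s ^ (2 * n + 1) * ‖η‖ ^ 2 := by positivity
    calc Real.exp (-L) * (z * c₀) * s ^ (2 * n + 1) * ‖η‖ ^ 2
        = Real.exp (-L) * (z * (c₀ * s ^ (2 * n + 1) * ‖η‖ ^ 2)) := by ring
      _ ≤ Real.exp (-L * s) * (z * (c₀ * s ^ (2 * n + 1) * ‖η‖ ^ 2)) := by
          gcongr ?_ * _; exact he2 s hs
      _ ≤ Real.exp (-L * s) * (z * S s η) := by gcongr
      _ ≤ _ := by gcongr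
  · intro s hs η
    have h1 := sq_norm_gramian_le (m := m) hs.1.le hs.2 (fun k => Q k s) (hb s hs) η
    have h2 := hzS s hs η
    have h0 := hs.1
    have h3 := hS0 s hs η
    have h4 : 0 ≤ inner ℝ η (G s η) := le_trans (by positivity) h2
    simp only [smul_apply, inner_smul_right, norm_smul]
    rw [mul_pow, Real.norm_eq_abs, sq_abs]
    calc Real.exp (-L * s) ^ 2 * ‖G s η‖ ^ 2
        ≤ Real.exp (-L * s) ^ 2 * (D * s * S s η) := by gcongr
      _ = Real.exp (-L * s) * (Real.exp (-L * s) * (D / z * s * (z * S s η))) := by field_simp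
      _ ≤ Real.exp (-L * s) * (1 * ((D / z + 1) * s * inner ℝ η (G s η))) := by
          gcongr
          · exact he1 s hs
          · linarith
      _ = _ := by ring
  · intro s hs η
    have h0 := hs.1
    have h1 := inner_gramianDeriv m n h0.ne' (P s) (fun k => Q k s) η
    have h2 := boundary_le_energy (m := m) hs hc₀ (fun k => Q k s) (hb s hs _ le_rfl) η (hc s hs η)
    have h3 : A * S s η ≤ L * inner ℝ η (G s η) := by
      calc A * S s η = L * (z * S s η) := by rw [hL]; field_simp
        _ ≤ _ := by gcongr; exact hzS s hs η
    simp only [smul_apply, add_apply, inner_add_right, inner_smul_right, map_smul]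
    have h4 : inner ℝ η (G' s η) + 2 * inner ℝ η (P s (G s η)) + m / s * inner ℝ η (G s η)
        - L * inner ℝ η (G s η) ≤ ‖adjoint (Q 0 s) η‖ ^ 2 := by
      simp only [hG, hG'] at *
      linarith
    calc _ = Real.exp (-L * s) * (inner ℝ η (G' s η) + 2 * inner ℝ η (P s (G s η))
          + m / s * inner ℝ η (G s η) - L * inner ℝ η (G s η)) := by ring
      _ ≤ Real.exp (-L * s) * ‖adjoint (Q 0 s) η‖ ^ 2 := by gcongr
      _ ≤ 1 * ‖adjoint (Q 0 s) η‖ ^ 2 := by gcongr; exact he1 s hs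
      _ = _ := one_mul _

end

/-! ### The feedback and its Lyapunov function -/

section

open ContinuousLinearMap (adjoint)

/-- The variable `s = e^{-τ}`, frozen at `s = 1` for negative `τ`. -/
def expTime (τ : ℝ) : ℝ := Real.exp (-max τ 0)

theorem expTime_of_nonneg {τ : ℝ} (hτ : 0 ≤ τ) : expTime τ = Real.exp (-τ) := by
  rw [expTime, max_eq_left hτ]

theorem expTime_mem (τ : ℝ) : expTime τ ∈ Ioc (0 : ℝ) 1 :=
  ⟨Real.exp_pos _, by rw [expTime, Real.exp_le_one_iff]; simp⟩

@[fun_prop]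
theorem continuous_expTime : Continuous expTime := by
  unfold expTime; fun_prop

variable {E : Type*} [NormedAddCommGroup E] [InnerProductSpace ℝ E] [FiniteDimensional ℝ E]
  {r : ℕ}

/-- The feedback `d = -Q* W⁻¹ c / 2`. -/
def feedback (Q : ℝ → Vec r →L[ℝ] E) (W : ℝ → E →L[ℝ] E) (τ : ℝ) : E →L[ℝ] Vec r :=
  -(1 / 2 : ℝ) • (adjoint (Q (expTime τ))).comp (Ring.inverse (W (expTime τ)))

/-- The Lyapunov function `⟪c, W⁻¹ c⟫`. -/
def lyap (W : ℝ → E →L[ℝ] E) (τ : ℝ) (y : E) : ℝ :=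
  inner ℝ (Ring.inverse (W (expTime τ)) y) y

namespace IsGramian

variable {m n : ℕ} {c C : ℝ} {P : ℝ → E →L[ℝ] E} {Q : ℝ → Vec r →L[ℝ] E} {W W' : ℝ → E →L[ℝ] E}

theorem isUnit (h : IsGramian m n c C P Q W W') (hc : 0 < c) {s : ℝ} (hs : s ∈ Ioc (0 : ℝ) 1) :
    IsUnit (W s) := by
  have hinj : Function.Injective (W s) := by
    rw [injective_iff_map_eq_zero]
    intro η hη
    have h1 := h.lower s hs η
    rw [hη, inner_zero_right] at h1
    by_contra hne
    have h0 := hs.1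
    have : 0 < c * s ^ (2 * n + 1) * ‖η‖ ^ 2 := by positivity
    linarith
  rw [ContinuousLinearMap.isUnit_iff_bijective]
  exact ⟨hinj, (LinearMap.injective_iff_surjective (f := (W s : E →ₗ[ℝ] E))).1 hinj⟩

theorem apply_inverse (h : IsGramian m n c C P Q W W') (hc : 0 < c) {s : ℝ}
    (hs : s ∈ Ioc (0 : ℝ) 1) (y : E) : W s (Ring.inverse (W s) y) = y := by
  have := Ring.mul_inverse_cancel _ (h.isUnit hc hs)
  exact congrArg (fun T : E →L[ℝ] E => T y) this

theorem hasDerivAt_inverse (h : IsGramian m n c C P Q W W') (hc : 0 < c) {s : ℝ}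
    (hs : s ∈ Ioc (0 : ℝ) 1) : HasDerivAt (fun s => Ring.inverse (W s))
      (-(Ring.inverse (W s) * W' s * Ring.inverse (W s))) s := by
  obtain ⟨u, hu⟩ := h.isUnit hc hs
  have h1 := hasFDerivAt_ringInverse (𝕜 := ℝ) u
  rw [hu] at h1
  have h2 := h1.comp_hasDerivAt s (h.hasDerivAt s)
  refine h2.congr_deriv ?_
  rw [← hu, Ring.inverse_unit]
  simp [ContinuousLinearMap.mulLeftRight_apply]

theorem continuous_inverse (h : IsGramian m n c C P Q W W') (hc : 0 < c) :
    Continuous fun τ => Ring.inverse (W (expTime τ)) :=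
  continuous_iff_continuousAt.2 fun τ =>
    ContinuousAt.comp (f := expTime) (g := fun s => Ring.inverse (W s))
      (h.hasDerivAt_inverse hc (expTime_mem τ)).continuousAt continuous_expTime.continuousAt

theorem continuous_feedback (h : IsGramian m n c C P Q W W') (hc : 0 < c) (hQ : Continuous Q) :
    Continuous (feedback Q W) := by
  have h1 := h.continuous_inverse hc
  have h2 : Continuous fun τ => adjoint (Q (expTime τ)) :=
    (LinearIsometryEquiv.continuous _).comp (hQ.comp continuous_expTime)
  unfold feedback
  exact (h2.clm_comp h1).const_smul (-(1 / 2 : ℝ))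

theorem lyap_eq (h : IsGramian m n c C P Q W W') (hc : 0 < c) (τ : ℝ) (y : E) :
    lyap W τ y = inner ℝ (Ring.inverse (W (expTime τ)) y)
      (W (expTime τ) (Ring.inverse (W (expTime τ)) y)) := by
  rw [h.apply_inverse hc (expTime_mem τ), lyap]

theorem lower_lyap (h : IsGramian m n c C P Q W W') (hc : 0 < c) (τ : ℝ) (y : E) :
    c * expTime τ ^ (2 * n + 1) * ‖Ring.inverse (W (expTime τ)) y‖ ^ 2 ≤ lyap W τ y := by
  rw [h.lyap_eq hc]
  exact h.lower _ (expTime_mem τ) _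

theorem lyap_nonneg (h : IsGramian m n c C P Q W W') (hc : 0 < c) (τ : ℝ) (y : E) :
    0 ≤ lyap W τ y := by
  refine le_trans ?_ (h.lower_lyap hc τ y)
  have := (expTime_mem τ).1
  positivity

theorem sq_norm_le_lyap (h : IsGramian m n c C P Q W W') (hc : 0 < c) (τ : ℝ) (y : E) :
    ‖y‖ ^ 2 ≤ C * expTime τ * lyap W τ y := by
  have := h.upper _ (expTime_mem τ) (Ring.inverse (W (expTime τ)) y)
  rwa [← h.lyap_eq hc, h.apply_inverse hc (expTime_mem τ)] at this

/-- Initially the Lyapunov function is bounded by a multiple of the square of the norm. -/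
theorem lyap_zero_le (h : IsGramian m n c C P Q W W') (hc : 0 < c) (y : E) :
    lyap W 0 y ≤ ‖y‖ ^ 2 / c := by
  have h0 : expTime 0 = 1 := by simp [expTime]
  have h1 := h.lower_lyap hc 0 y
  set η := Ring.inverse (W (expTime 0)) y with hη
  have h2 : lyap W 0 y ≤ ‖η‖ * ‖y‖ := real_inner_le_norm _ _
  rw [h0, one_pow, mul_one] at h1
  have h3 : c * ‖η‖ ≤ ‖y‖ := by
    by_contra! hcon
    have h4 : 0 < ‖η‖ := by
      by_contra! h5
      have : ‖η‖ = 0 := le_antisymm h5 (norm_nonneg _)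
      rw [this, mul_zero] at hcon
      exact absurd hcon (not_lt.2 (norm_nonneg _))
    have : ‖η‖ * ‖y‖ < ‖η‖ * (c * ‖η‖) := by gcongr
    nlinarith
  rw [le_div_iff₀ hc]
  nlinarith [norm_nonneg y]

/-- The Lyapunov function along a solution of the perturbed closed system. -/
theorem hasDerivWithinAt_lyap (h : IsGramian m n c C P Q W W') (hc : 0 < c) {y : ℝ → E} {g : E}
    {τ : ℝ} (hτ : 0 ≤ τ)
    (hy : HasDerivWithinAt y (expTime τ • (P (expTime τ) (y τ)
      + Q (expTime τ) (feedback Q W τ (y τ)) + g)) (Ici 0) τ) :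
    ∃ V', HasDerivWithinAt (fun τ => lyap W τ (y τ)) V' (Ici 0) τ ∧
      V' ≤ -m * lyap W τ (y τ)
        + 2 * expTime τ * inner ℝ (Ring.inverse (W (expTime τ)) (y τ)) g := by
  have hs := expTime_mem τ
  have hsd : HasDerivWithinAt expTime (-expTime τ) (Ici 0) τ := by
    have h1 : HasDerivAt (fun τ : ℝ => Real.exp (-τ)) (-Real.exp (-τ)) τ := by
      simpa using (hasDerivAt_neg τ).exp
    rw [← expTime_of_nonneg hτ] at h1
    exact h1.hasDerivWithinAt.congr (fun x hx => expTime_of_nonneg hx) (expTime_of_nonneg hτ)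
  have hR := (h.hasDerivAt_inverse hc hs).scomp_hasDerivWithinAt τ hsd
  have hRy := hR.clm_apply hy
  have hV := hRy.inner ℝ hy
  have hsym : ∀ a b, inner ℝ (Ring.inverse (W (expTime τ)) a) b
      = inner ℝ a (Ring.inverse (W (expTime τ)) b) := by
    intro a b
    conv_lhs => rw [← h.apply_inverse hc hs b]
    rw [h.symm, h.apply_inverse hc hs a]
  refine ⟨_, hV, ?_⟩
  have hd : feedback Q W τ (y τ) = -(1 / 2 : ℝ) • adjoint (Q (expTime τ))
      (Ring.inverse (W (expTime τ)) (y τ)) := rfl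
  rw [h.lyap_eq hc, hd]
  have hL := h.lyapunov _ hs (Ring.inverse (W (expTime τ)) (y τ))
  simp only [h.apply_inverse hc hs (y τ)] at *
  simp only [Function.comp_apply]
  generalize expTime τ = s at *
  set η := Ring.inverse (W s) (y τ) with hη
  set d := P s (y τ) + Q s (-(1 / 2 : ℝ) • adjoint (Q s) η) + g with hd'
  have e0 : ((-s • -(Ring.inverse (W s) * W' s * Ring.inverse (W s))) (y τ) : E)
      = s • Ring.inverse (W s) (W' s η) := by
    rw [neg_smul_neg]; rfl
  have e1 : inner ℝ η d = inner ℝ η (P s (y τ)) - 1 / 2 * ‖adjoint (Q s) η‖ ^ 2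
      + inner ℝ η g := by
    rw [hd', inner_add_right, inner_add_right, map_smul, inner_smul_right,
      ← ContinuousLinearMap.adjoint_inner_left (Q s), real_inner_self_eq_norm_sq]
    ring
  have e2 := mul_le_mul_of_nonneg_left hL hs.1.le
  have e3 : s * (m / s * inner ℝ η (y τ)) = m * inner ℝ η (y τ) := by
    field_simp [hs.1.ne']
  rw [e0, inner_add_left, real_inner_smul_left, hsym (W' s η), hsym (s • d), ← hη,
    real_inner_smul_left, inner_smul_right, real_inner_comm η d, real_inner_comm η (W' s η), e1]
  nlinarith [e2, e3]

end IsGramian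

end

/-! ### Decay of the linear and of the perturbed closed system -/

section

open ContinuousLinearMap (adjoint)

variable {E : Type*} [NormedAddCommGroup E] [InnerProductSpace ℝ E] [FiniteDimensional ℝ E]
  {r : ℕ}

namespace IsGramian

variable {m n : ℕ} {c C : ℝ} {P : ℝ → E →L[ℝ] E} {Q : ℝ → Vec r →L[ℝ] E} {W W' : ℝ → E →L[ℝ] E}

/-- The Lyapunov function divided by `s^m`. -/
theorem hasDerivWithinAt_exp_mul_lyap (h : IsGramian m n c C P Q W W') (hc : 0 < c) {y : ℝ → E}
    {g : E} {τ : ℝ} (hτ : 0 ≤ τ)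
    (hy : HasDerivWithinAt y (expTime τ • (P (expTime τ) (y τ)
      + Q (expTime τ) (feedback Q W τ (y τ)) + g)) (Ici 0) τ) :
    ∃ U', HasDerivWithinAt (fun τ => Real.exp (m * τ) * lyap W τ (y τ)) U' (Ici 0) τ ∧
      U' ≤ 2 * Real.exp (m * τ) * expTime τ * inner ℝ (Ring.inverse (W (expTime τ)) (y τ)) g := by
  obtain ⟨V', hV, hV'⟩ := h.hasDerivWithinAt_lyap hc hτ hy
  have h1 : HasDerivAt (fun τ : ℝ => Real.exp (m * τ)) (Real.exp (m * τ) * m) τ := by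
    simpa using ((hasDerivAt_id τ).const_mul (m : ℝ)).exp
  refine ⟨_, h1.hasDerivWithinAt.mul hV, ?_⟩
  have h2 := mul_le_mul_of_nonneg_left hV' (Real.exp_pos (m * τ)).le
  linarith

theorem lyap_le_of_linear (h : IsGramian m n c C P Q W W') (hc : 0 < c) {y : ℝ → E}
    (hy : ∀ τ, 0 ≤ τ → HasDerivWithinAt y (expTime τ • (P (expTime τ) (y τ)
      + Q (expTime τ) (feedback Q W τ (y τ)))) (Ici 0) τ) {τ : ℝ} (hτ : 0 ≤ τ) :
    Real.exp (m * τ) * lyap W τ (y τ) ≤ lyap W 0 (y 0) := by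
  have hd : ∀ τ, 0 ≤ τ → ∃ U',
      HasDerivWithinAt (fun τ => Real.exp (m * τ) * lyap W τ (y τ)) U' (Ici 0) τ ∧ U' ≤ 0 := by
    intro τ hτ
    have := h.hasDerivWithinAt_exp_mul_lyap hc (g := 0) hτ (by simpa using hy τ hτ)
    simpa using this
  choose! U' hU hU0 using hd
  have := image_le_of_deriv_right_le_deriv_boundary (a := 0) (b := τ)
    (f := fun τ => Real.exp (m * τ) * lyap W τ (y τ)) (f' := U')
    (B := fun _ => lyap W 0 (y 0)) (B' := fun _ => 0)
    (fun t ht => (hU t ht.1).continuousWithinAt.mono Icc_subset_Ici_self)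
    (fun t ht => (hU t ht.1).mono (Ici_subset_Ici.2 ht.1)) (by simp) continuousOn_const
    (fun t _ => hasDerivWithinAt_const _ _ _) (fun t ht => hU0 t ht.1)
  exact this ⟨hτ, le_rfl⟩

/-- The fundamental matrix of the closed linear system decreases exponentially. -/
theorem exists_fundamental (h : IsGramian m n c C P Q W W') (hc : 0 < c) (hC : 0 < C)
    (hP : Continuous P) (hQ : Continuous Q) :
    ∃ Φ : ℝ → E →L[ℝ] E, Φ 0 = ContinuousLinearMap.id ℝ E ∧
      (∀ τ, 0 ≤ τ → HasDerivAt Φ ((expTime τ • P (expTime τ)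
        + (expTime τ • Q (expTime τ)).comp (feedback Q W τ)).comp (Φ τ)) τ) ∧
      ∃ K > 0, ∃ lam > 0, ∀ τ, 0 ≤ τ → ‖Φ τ‖ ≤ K * Real.exp (-lam * τ) := by
  set A : ℝ → E →L[ℝ] E := fun τ => expTime τ • P (expTime τ)
        + (expTime τ • Q (expTime τ)).comp (feedback Q W τ) with hA
  have hM := h.continuous_feedback hc hQ
  have hAc : Continuous A := by
    have h1 : Continuous fun τ => P (expTime τ) := hP.comp continuous_expTime
    have h2 : Continuous fun τ => Q (expTime τ) := hQ.comp continuous_expTime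
    exact (continuous_expTime.smul h1).add ((continuous_expTime.smul h2).clm_comp hM)
  clear_value A
  have hAc2 : Continuous fun p : ℝ × (E →L[ℝ] E) => (A p.1).comp p.2 :=
    Continuous.clm_comp (hAc.comp continuous_fst) continuous_snd
  obtain ⟨Φ, hΦ0, hΦ⟩ := exists_global_solution (fun τ Φ => (A τ).comp Φ) (fun τ => ‖A τ‖)
    hAc.norm (fun _ => norm_nonneg _)
    hAc2
    (fun t x y => by rw [← ContinuousLinearMap.comp_sub]; exact ContinuousLinearMap.opNorm_comp_le _ _)
    (ContinuousLinearMap.id ℝ E)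
  refine ⟨Φ, hΦ0, fun τ hτ => by simpa only [hA] using hΦ τ hτ,
    Real.sqrt (C / c), by positivity, 1 / 2, by norm_num, fun τ hτ => ?_⟩
  refine ContinuousLinearMap.opNorm_le_bound _ (by positivity) fun v => ?_
  have h1 := h.lyap_le_of_linear hc (y := fun τ => Φ τ v) (fun τ hτ => by
    have := (hΦ τ hτ).clm_apply (hasDerivAt_const τ v)
    simpa [hA, smul_add] using this.hasDerivWithinAt) hτ
  have h2 := h.sq_norm_le_lyap hc τ (Φ τ v)
  have h3 := h.lyap_zero_le hc (Φ 0 v)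
  have h4 : Φ 0 v = v := by rw [hΦ0]; rfl
  rw [h4] at h1 h3
  have h5 : lyap W τ (Φ τ v) ≤ ‖v‖ ^ 2 / c := by
    refine le_trans ?_ (h1.trans h3)
    refine le_mul_of_one_le_left (h.lyap_nonneg hc τ _) (Real.one_le_exp (by positivity))
  have h6 : expTime τ = Real.exp (-(1 / 2) * τ) ^ 2 := by
    rw [expTime_of_nonneg hτ, ← Real.exp_nat_mul]; congr 1; push_cast; ring
  refine abs_le_of_sq_le_sq' ?_ (by positivity) |>.2
  rw [mul_pow, mul_pow, Real.sq_sqrt (by positivity), ← h6]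
  have h0 := (expTime_mem τ).1
  calc ‖Φ τ v‖ ^ 2 ≤ C * expTime τ * lyap W τ (Φ τ v) := h2
    _ ≤ C * expTime τ * (‖v‖ ^ 2 / c) := by gcongr
    _ = _ := by ring

/-- Bound for `η = W⁻¹ y` in terms of `V = ⟪y, W⁻¹ y⟫`, where `σ ^ 2 = s` and
`V = (σ ^ (6 n + 6) * w) ^ 2`. -/
theorem norm_inverse_le (h : IsGramian m n c C P Q W W') (hc : 0 < c) {τ σ w : ℝ} {y : E}
    (hσ : 0 < σ) (hσ2 : σ ^ 2 = expTime τ) (hw : 0 ≤ w)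
    (hV : lyap W τ y = (σ ^ (6 * n + 6) * w) ^ 2) :
    ‖Ring.inverse (W (expTime τ)) y‖ ≤ (Real.sqrt c)⁻¹ * (σ ^ (4 * n + 5) * w) := by
  have h1 := h.lower_lyap hc τ y
  rw [hV, ← hσ2] at h1
  rw [← hσ2]
  set x := ‖Ring.inverse (W (σ ^ 2)) y‖ with hx
  have h2 : (Real.sqrt c * (σ ^ (2 * n + 1) * x)) ^ 2 ≤ (σ ^ (6 * n + 6) * w) ^ 2 := by
    rw [mul_pow, Real.sq_sqrt hc.le]
    calc c * (σ ^ (2 * n + 1) * x) ^ 2 = c * (σ ^ 2) ^ (2 * n + 1) * x ^ 2 := by ring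
      _ ≤ _ := h1
  have h3 := (abs_le_of_sq_le_sq' h2 (by positivity)).2
  rw [inv_mul_eq_div, le_div_iff₀ (by positivity)]
  have h4 : σ ^ (2 * n + 1) * (x * Real.sqrt c) ≤ σ ^ (2 * n + 1) * (σ ^ (4 * n + 5) * w) := by
    calc _ = Real.sqrt c * (σ ^ (2 * n + 1) * x) := by ring
      _ ≤ _ := h3
      _ = _ := by ring
  exact le_of_mul_le_mul_left h4 (by positivity)

theorem norm_feedback_le {b : ℝ} {τ : ℝ} (hQ : ‖Q (expTime τ)‖ ≤ b) (y : E) :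
    ‖feedback Q W τ y‖ ≤ b * ‖Ring.inverse (W (expTime τ)) y‖ := by
  have hd : feedback Q W τ y = -(1 / 2 : ℝ) • adjoint (Q (expTime τ))
      (Ring.inverse (W (expTime τ)) y) := rfl
  rw [hd, norm_smul]
  set η := Ring.inverse (W (expTime τ)) y
  have h1 : ‖adjoint (Q (expTime τ)) η‖ ≤ b * ‖η‖ :=
    ((adjoint (Q (expTime τ))).le_opNorm η).trans (by
      rw [LinearIsometryEquiv.norm_map]; gcongr)
  have h2 : ‖(-(1 / 2) : ℝ)‖ ≤ 1 := by norm_num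
  nlinarith [norm_nonneg (adjoint (Q (expTime τ)) η)]

theorem norm_state_le (h : IsGramian m n c C P Q W W') (hc : 0 < c) (hC : 0 < C) {τ σ w : ℝ}
    {y : E} (hσ : 0 < σ) (hσ2 : σ ^ 2 = expTime τ) (hw : 0 ≤ w)
    (hV : lyap W τ y = (σ ^ (6 * n + 6) * w) ^ 2) :
    ‖y‖ ≤ Real.sqrt C * (σ ^ (6 * n + 7) * w) := by
  have h1 := h.sq_norm_le_lyap hc τ y
  refine (abs_le_of_sq_le_sq' ?_ (by positivity)).2
  rw [mul_pow, Real.sq_sqrt hC.le]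
  calc ‖y‖ ^ 2 ≤ _ := h1
    _ = _ := by rw [hV, ← hσ2]; ring

set_option maxHeartbeats 400000 in
/-- Bounds for the perturbed closed system: as long as the weighted Lyapunov function is small,
its growth rate is integrable in time, so it stays small. The exponents fit because the
perturbation consists of a residual of order `s^(4N-1)`, linear terms of orders `s^N` and
`s^(2N)` in the state and the control, and a quadratic term, with `N = n + 1`. -/
theorem lyap_le_of_perturbation {c C b B : ℝ} (n : ℕ) (hc : 0 < c) (hC : 0 < C) (hb : 0 ≤ b)
    (hB : 0 ≤ B) :
    ∃ K > 0, ∀ (P : ℝ → E →L[ℝ] E) (Q : ℝ → Vec r →L[ℝ] E) (W W' : ℝ → E →L[ℝ] E),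
      IsGramian (6 * n + 6) n c C P Q W W' → (∀ s ∈ Ioc (0 : ℝ) 1, ‖Q s‖ ≤ b) →
      ∀ (e β : ℝ) (y g : ℝ → E), 0 ≤ e → e ≤ 1 → 0 < β → β ≤ 1 → K * e ≤ β →
      K * ‖y 0‖ ^ 2 ≤ β →
      (∀ τ, 0 ≤ τ → HasDerivWithinAt y (expTime τ • (P (expTime τ) (y τ)
        + Q (expTime τ) (feedback Q W τ (y τ)) + g τ)) (Ici 0) τ) →
      (∀ τ, 0 ≤ τ → ‖g τ‖ ≤ e * expTime τ ^ (4 * n + 3) + B * (expTime τ ^ (n + 1) * ‖y τ‖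
        + expTime τ ^ (2 * n + 2) * ‖feedback Q W τ (y τ)‖
        + max ‖y τ‖ ‖feedback Q W τ (y τ)‖ ^ 2)) →
      ∀ τ, 0 ≤ τ → ‖y τ‖ ^ 2 ≤ K * β * expTime τ ∧
        ‖feedback Q W τ (y τ)‖ ^ 2 ≤ K * β * expTime τ := by
  -- `k` bounds the constants in the estimates of `W⁻¹ y`, of the control and of the state
  set k : ℝ := (1 + b) * (Real.sqrt c)⁻¹ + Real.sqrt C with hk
  have hk0 : 0 < k := by positivity
  have hk1 : (Real.sqrt c)⁻¹ ≤ k := by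
    have : 0 ≤ b * (Real.sqrt c)⁻¹ + Real.sqrt C := by positivity
    rw [hk]; linarith
  have hk2 : b * (Real.sqrt c)⁻¹ ≤ k := by
    have : 0 ≤ (Real.sqrt c)⁻¹ + Real.sqrt C := by positivity
    rw [hk]; linarith
  have hk3 : Real.sqrt C ≤ k := by
    have : 0 ≤ (1 + b) * (Real.sqrt c)⁻¹ := by positivity
    rw [hk]; linarith
  -- the weighted Lyapunov function grows at most at the rate `(L - 1) e^{-τ/2}`, so it cannot
  -- cross the barrier `F` below, whose rate is `L e^{-τ/2}` and whose total growth is bounded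
  set L : ℝ := 2 * k * (1 + B * (2 * k + k ^ 2)) + 1 with hL
  have hL0 : 0 < L := by positivity
  refine ⟨k ^ 2 + Real.exp (2 * L) * (1 + 1 / c), by positivity, ?_⟩
  intro P Q W W' h hQ e β y g he0 he1 hβ0 hβ1 heβ hyβ hy hg
  have hbound : ∀ τ σ w : ℝ, 0 < σ → σ ^ 2 = expTime τ → 0 ≤ w →
      lyap W τ (y τ) = (σ ^ (6 * n + 6) * w) ^ 2 →
      ‖Ring.inverse (W (expTime τ)) (y τ)‖ ≤ k * (σ ^ (4 * n + 5) * w) ∧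
      ‖feedback Q W τ (y τ)‖ ≤ k * (σ ^ (4 * n + 5) * w) ∧
      ‖y τ‖ ≤ k * (σ ^ (6 * n + 7) * w) := by
    intro τ σ w hσ hσ2 hw hV
    have h1 := h.norm_inverse_le hc hσ hσ2 hw hV
    refine ⟨h1.trans (by gcongr), ?_, (h.norm_state_le hc hC hσ hσ2 hw hV).trans (by gcongr)⟩
    refine (norm_feedback_le (hQ _ (expTime_mem τ)) _).trans ?_
    calc _ ≤ b * ((Real.sqrt c)⁻¹ * (σ ^ (4 * n + 5) * w)) := by gcongr
      _ = b * (Real.sqrt c)⁻¹ * (σ ^ (4 * n + 5) * w) := by ring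
      _ ≤ _ := by gcongr
  set U : ℝ → ℝ := fun τ => Real.exp ((6 * n + 6 : ℕ) * τ) * lyap W τ (y τ) with hU
  have hUd : ∀ τ, 0 ≤ τ → ∃ U', HasDerivWithinAt U U' (Ici 0) τ ∧
      U' ≤ 2 * Real.exp ((6 * n + 6 : ℕ) * τ) * expTime τ
        * inner ℝ (Ring.inverse (W (expTime τ)) (y τ)) (g τ) :=
    fun τ hτ => h.hasDerivWithinAt_exp_mul_lyap hc hτ (hy τ hτ)
  choose! U' hUU' hU'le using hUd
  have hU0 : ∀ τ, 0 ≤ U τ := fun τ => mul_nonneg (Real.exp_pos _).le (h.lyap_nonneg hc _ _)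
  have hσ2 : ∀ τ, 0 ≤ τ → Real.exp (-τ / 2) ^ 2 = expTime τ := fun τ hτ => by
    rw [expTime_of_nonneg hτ, ← Real.exp_nat_mul]; congr 1; push_cast; ring
  have hexp : ∀ τ, Real.exp ((6 * n + 6 : ℕ) * τ) * (Real.exp (-τ / 2) ^ (6 * n + 6)) ^ 2 = 1 := by
    intro τ
    rw [← Real.exp_nat_mul, ← Real.exp_nat_mul, ← Real.exp_add, Real.exp_eq_one_iff]
    push_cast; ring
  have hVU : ∀ τ, 0 ≤ τ → lyap W τ (y τ)
      = (Real.exp (-τ / 2) ^ (6 * n + 6) * Real.sqrt (U τ)) ^ 2 := by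
    intro τ hτ
    rw [mul_pow, Real.sq_sqrt (hU0 τ), hU]
    have := hexp τ
    linear_combination (-lyap W τ (y τ)) * this
  set F : ℝ → ℝ := fun τ => β * Real.exp (-2 * L * Real.exp (-τ / 2)) with hF
  have hFd : ∀ τ, HasDerivAt F (L * Real.exp (-τ / 2) * F τ) τ := by
    intro τ
    have h1 : HasDerivAt (fun τ : ℝ => Real.exp (-τ / 2)) (Real.exp (-τ / 2) * (-1 / 2)) τ :=
      ((hasDerivAt_neg τ).div_const 2).exp
    have h2 := ((h1.const_mul (-2 * L)).exp).const_mul β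
    refine h2.congr_deriv ?_
    simp only [hF]; ring
  have hσ1 : ∀ τ : ℝ, 0 ≤ τ → Real.exp (-τ / 2) ≤ 1 := fun τ hτ => by
    rw [Real.exp_le_one_iff]; linarith
  have hFpos : ∀ τ, 0 < F τ := fun τ => by positivity
  have hFβ : ∀ τ, F τ ≤ β := fun τ => by
    refine mul_le_of_le_one_right hβ0.le ?_
    rw [Real.exp_le_one_iff]
    have := Real.exp_pos (-τ / 2)
    nlinarith
  have hFlow : ∀ τ : ℝ, 0 ≤ τ → β * Real.exp (-(2 * L)) ≤ F τ := fun τ hτ => by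
    simp only [hF]
    gcongr
    have := hσ1 τ hτ
    nlinarith
  have hKexp : ∀ x : ℝ, 0 ≤ x → (k ^ 2 + Real.exp (2 * L) * (1 + 1 / c)) * x ≤ β →
      (1 + 1 / c) * x ≤ β * Real.exp (-(2 * L)) := by
    intro x hx hxβ
    rw [Real.exp_neg, ← div_eq_mul_inv, le_div_iff₀ (Real.exp_pos _)]
    have : 0 ≤ k ^ 2 * x := by positivity
    linarith
  have heF : ∀ τ, 0 ≤ τ → e ^ 2 ≤ F τ := by
    intro τ hτ
    refine le_trans ?_ ((hKexp e he0 heβ).trans (hFlow τ hτ))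
    have : 0 ≤ 1 / c * e := by positivity
    nlinarith
  have hUF : ∀ τ, 0 ≤ τ → U τ ≤ F τ := by
    intro T hT
    refine image_le_of_deriv_right_lt_deriv_boundary (a := 0) (b := T) (f := U) (f' := U')
      (B := F) (B' := fun τ => L * Real.exp (-τ / 2) * F τ)
      (fun t ht => (hUU' t ht.1).continuousWithinAt.mono Icc_subset_Ici_self)
      (fun t ht => (hUU' t ht.1).mono (Ici_subset_Ici.2 ht.1)) ?_ hFd ?_ ⟨hT, le_rfl⟩
    · refine le_trans ?_ ((hKexp _ (by positivity) hyβ).trans (hFlow 0 le_rfl))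
      simp only [hU, mul_zero, Real.exp_zero, one_mul]
      refine (h.lyap_zero_le hc (y 0)).trans ?_
      have : 0 ≤ ‖y 0‖ ^ 2 := by positivity
      calc ‖y 0‖ ^ 2 / c = (1 / c) * ‖y 0‖ ^ 2 := by ring
        _ ≤ _ := by gcongr; linarith
    · intro τ hτ hUτ
      have hτ0 := hτ.1
      set σ := Real.exp (-τ / 2) with hσ
      have hσpos : 0 < σ := Real.exp_pos _
      have hσle : σ ≤ 1 := hσ1 τ hτ0
      set w := Real.sqrt (U τ) with hw
      have hw0 : 0 ≤ w := Real.sqrt_nonneg _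
      have hw2 : w ^ 2 = F τ := by rw [hw, Real.sq_sqrt (hU0 τ), hUτ]
      have hw1 : w ≤ 1 := by
        have := (hFβ τ).trans hβ1
        nlinarith
      have hew : e ≤ w := by
        have := heF τ hτ0
        rw [← hw2] at this
        exact (abs_le_of_sq_le_sq' this hw0).2
      obtain ⟨b1, b2, b3⟩ := hbound τ σ w hσpos (hσ2 τ hτ0) hw0 (hVU τ hτ0)
      have hgτ := hg τ hτ0
      have b3' : ‖y τ‖ ≤ k * (σ ^ (4 * n + 5) * w) := b3.trans (by
        gcongr ?_ * (?_ * _)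
        exact pow_le_pow_of_le_one hσpos.le hσle (by omega))
      have b4 := max_le b3' b2
      set M := max ‖y τ‖ ‖feedback Q W τ (y τ)‖ with hM
      have hM0 : 0 ≤ M := le_trans (norm_nonneg _) (le_max_left _ _)
      have hpow : ∀ i : ℕ, 8 * n + 6 ≤ i → σ ^ i ≤ σ ^ (8 * n + 6) := fun i hi =>
        pow_le_pow_of_le_one hσpos.le hσle hi
      have hg2 : ‖g τ‖ ≤ σ ^ (8 * n + 6) * (w * (1 + B * (2 * k + k ^ 2))) := by
        rw [← hσ2 τ hτ0] at hgτ
        calc ‖g τ‖ ≤ _ := hgτ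
          _ ≤ w * (σ ^ 2) ^ (4 * n + 3) + B * ((σ ^ 2) ^ (n + 1) * (k * (σ ^ (6 * n + 7) * w))
            + (σ ^ 2) ^ (2 * n + 2) * (k * (σ ^ (4 * n + 5) * w))
            + (k * (σ ^ (4 * n + 5) * w)) ^ 2) := by gcongr
          _ = w * σ ^ (8 * n + 6) + B * (k * w * σ ^ (8 * n + 9) + k * w * σ ^ (8 * n + 9)
            + k ^ 2 * (w * w) * σ ^ (8 * n + 10)) := by ring
          _ ≤ w * σ ^ (8 * n + 6) + B * (k * w * σ ^ (8 * n + 6) + k * w * σ ^ (8 * n + 6)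
            + k ^ 2 * (w * 1) * σ ^ (8 * n + 6)) := by
              gcongr w * σ ^ (8 * n + 6) + B * (k * w * ?_ + k * w * ?_ + k ^ 2 * (w * ?_) * ?_)
              · exact hpow _ (by omega)
              · exact hpow _ (by omega)
              · exact hpow _ (by omega)
          _ = _ := by ring
      have hin : inner ℝ (Ring.inverse (W (expTime τ)) (y τ)) (g τ)
          ≤ k * (σ ^ (4 * n + 5) * w) * (σ ^ (8 * n + 6) * (w * (1 + B * (2 * k + k ^ 2)))) :=
        (real_inner_le_norm _ _).trans (by gcongr)
      calc U' τ ≤ _ := hU'le τ hτ0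
        _ ≤ 2 * Real.exp ((6 * n + 6 : ℕ) * τ) * expTime τ * (k * (σ ^ (4 * n + 5) * w)
            * (σ ^ (8 * n + 6) * (w * (1 + B * (2 * k + k ^ 2))))) := by
            have := (expTime_mem τ).1
            gcongr
        _ = (Real.exp ((6 * n + 6 : ℕ) * τ) * (σ ^ (6 * n + 6)) ^ 2)
            * (σ * (2 * k * (1 + B * (2 * k + k ^ 2))) * w ^ 2) := by
            rw [← hσ2 τ hτ0]; ring
        _ = (L - 1) * σ * F τ := by rw [hexp, hw2, hL]; ring
        _ < L * σ * F τ := by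
            have := hFpos τ
            gcongr
            linarith
  intro τ hτ
  set σ := Real.exp (-τ / 2) with hσ
  have hσpos : 0 < σ := Real.exp_pos _
  have hσle : σ ≤ 1 := hσ1 τ hτ
  obtain ⟨-, b2, b3⟩ := hbound τ σ _ hσpos (hσ2 τ hτ) (Real.sqrt_nonneg _) (hVU τ hτ)
  have hfin : ∀ (x : ℝ) (i : ℕ), 0 ≤ x → 1 ≤ i → x ≤ k * (σ ^ i * Real.sqrt (U τ)) →
      x ^ 2 ≤ (k ^ 2 + Real.exp (2 * L) * (1 + 1 / c)) * β * expTime τ := by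
    intro x i hx hi hxi
    have h1 : σ ^ i ≤ σ := by
      simpa using pow_le_pow_of_le_one hσpos.le hσle hi
    have h2 : U τ ≤ β := (hUF τ hτ).trans (hFβ τ)
    calc x ^ 2 ≤ (k * (σ ^ i * Real.sqrt (U τ))) ^ 2 := by gcongr
      _ ≤ (k * (σ * Real.sqrt (U τ))) ^ 2 := by gcongr
      _ = k ^ 2 * U τ * expTime τ := by
          rw [mul_pow, mul_pow, Real.sq_sqrt (hU0 τ), hσ2 τ hτ]; ring
      _ ≤ _ := by
          have h3 : k ^ 2 ≤ k ^ 2 + Real.exp (2 * L) * (1 + 1 / c) :=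
            le_add_of_nonneg_right (by positivity)
          exact mul_le_mul_of_nonneg_right
            (mul_le_mul h3 h2 (hU0 τ) ((sq_nonneg k).trans h3)) (expTime_mem τ).1.le
  exact ⟨hfin _ _ (norm_nonneg _) (by omega) b3, hfin _ _ (norm_nonneg _) (by omega) b2⟩

end IsGramian

end

/-! ### Taylor expansions with a parameter -/

section

open Filter Topology

theorem contDiff_iteratedDeriv_param {X G : Type*} [NormedAddCommGroup X] [NormedSpace ℝ X]
    [NormedAddCommGroup G] [NormedSpace ℝ G] {F : X × ℝ → G} :
    ∀ (k N : ℕ), ContDiff ℝ ((N + k : ℕ) : WithTop ℕ∞) F →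
      ContDiff ℝ (N : WithTop ℕ∞) fun p : X × ℝ => iteratedDeriv k (fun s => F (p.1, s)) p.2 := by
  intro k
  induction k with
  | zero => intro N hF; simpa using hF
  | succ k ih =>
    intro N hF
    have h1 := ih (N + 1) (by convert hF using 2; omega)
    set H : X × ℝ → G := fun p => iteratedDeriv k (fun s => F (p.1, s)) p.2 with hH
    have h2 : ∀ p : X × ℝ, iteratedDeriv (k + 1) (fun s => F (p.1, s)) p.2
        = fderiv ℝ H p (0, 1) := by
      intro p
      rw [iteratedDeriv_succ]
      have h3 : HasFDerivAt H (fderiv ℝ H p) p :=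
        ((h1.differentiable (by norm_cast)) p).hasFDerivAt
      have h4 : HasDerivAt (fun s : ℝ => (p.1, s)) ((0 : X), (1 : ℝ)) p.2 :=
        (hasDerivAt_const _ _).prodMk (hasDerivAt_id _)
      exact (HasFDerivAt.comp_hasDerivAt (f := fun s : ℝ => (p.1, s)) p.2 h3 h4).deriv
    simp_rw [h2]
    exact (h1.fderiv_right (by norm_cast)).clm_apply contDiff_const

theorem norm_sub_taylor_le {G : Type*} [NormedAddCommGroup G] [NormedSpace ℝ G] {g : ℝ → G}
    {N : ℕ} {C : ℝ} (hg : ContDiff ℝ (N : WithTop ℕ∞) g)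
    (hC : ∀ s ∈ Icc (0 : ℝ) 1, ‖iteratedDeriv N g s‖ ≤ C) :
    ∀ s ∈ Icc (0 : ℝ) 1,
      ‖g s - ∑ i ∈ Finset.range N, (s ^ i / (i.factorial : ℝ)) • iteratedDeriv i g 0‖
        ≤ C * s ^ N := by
  intro s hs
  rcases N with _ | N
  · simpa using hC s hs
  have hw : ∀ i ≤ N + 1, ∀ x ∈ Icc (0 : ℝ) 1,
      iteratedDerivWithin i g (Icc 0 1) x = iteratedDeriv i g x := fun i hi x hx =>
    iteratedDerivWithin_eq_iteratedDeriv (uniqueDiffOn_Icc one_pos)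
      ((hg.of_le (by exact_mod_cast hi)).contDiffAt) hx
  have h := taylor_mean_remainder_bound zero_le_one hg.contDiffOn hs
    (fun y hy => by rw [hw _ le_rfl y hy]; exact hC y hy)
  rw [taylor_within_apply, sub_zero] at h
  have hC0 : 0 ≤ C := (norm_nonneg _).trans (hC 0 (by simp))
  have e : ∑ i ∈ Finset.range (N + 1), (s ^ i / (i.factorial : ℝ)) • iteratedDeriv i g 0
      = ∑ k ∈ Finset.range (N + 1), (((k.factorial : ℝ)⁻¹ * s ^ k) •
        iteratedDerivWithin k g (Icc 0 1) 0) := by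
    refine Finset.sum_congr rfl fun i hi => ?_
    rw [hw i (Finset.mem_range.1 hi).le 0 (by simp), div_eq_inv_mul]
  rw [e]
  refine h.trans (div_le_self (by have := hs.1; positivity) ?_)
  exact_mod_cast N.factorial_pos

theorem eq_zero_of_norm_sum_pow_le {G : Type*} [NormedAddCommGroup G] [NormedSpace ℝ G] {C : ℝ} :
    ∀ (K : ℕ) (c : ℕ → G),
      (∀ s ∈ Ioc (0 : ℝ) 1, ‖∑ i ∈ Finset.range K, s ^ i • c i‖ ≤ C * s ^ K) →
      ∀ i < K, c i = 0 := by
  intro K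
  induction K with
  | zero => intro c _ i hi; omega
  | succ K ih =>
    intro c h
    have h0 : c 0 = 0 := by
      have hc1 : Tendsto (fun s : ℝ => ‖∑ i ∈ Finset.range (K + 1), s ^ i • c i‖) (𝓝[>] 0)
          (𝓝 ‖∑ i ∈ Finset.range (K + 1), (0 : ℝ) ^ i • c i‖) :=
        ((by fun_prop : Continuous fun s : ℝ => ‖∑ i ∈ Finset.range (K + 1), s ^ i • c i‖).tendsto
          0).mono_left nhdsWithin_le_nhds
      have hc2 : Tendsto (fun s : ℝ => C * s ^ (K + 1)) (𝓝[>] 0) (𝓝 (C * 0 ^ (K + 1))) :=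
        ((by fun_prop : Continuous fun s : ℝ => C * s ^ (K + 1)).tendsto 0).mono_left
          nhdsWithin_le_nhds
      have h1 := le_of_tendsto_of_tendsto hc1 hc2 (by
        filter_upwards [Ioc_mem_nhdsGT (one_pos : (0 : ℝ) < 1)] with s hs using h s hs)
      rw [Finset.sum_range_succ'] at h1
      simpa using h1
    have h2 := ih (fun i => c (i + 1)) (by
      intro s hs
      have h1 := h s hs
      rw [Finset.sum_range_succ', h0, smul_zero, add_zero] at h1
      have e : ∑ i ∈ Finset.range K, s ^ (i + 1) • c (i + 1)
          = s • ∑ i ∈ Finset.range K, s ^ i • c (i + 1) := by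
        rw [Finset.smul_sum]
        exact Finset.sum_congr rfl fun i _ => by rw [smul_smul, pow_succ']
      rw [e, norm_smul, Real.norm_eq_abs, abs_of_pos hs.1] at h1
      have : s * ‖∑ i ∈ Finset.range K, s ^ i • c (i + 1)‖ ≤ s * (C * s ^ K) :=
        h1.trans (le_of_eq (by ring))
      exact le_of_mul_le_mul_left this hs.1)
    intro i hi
    rcases i with _ | i
    · exact h0
    · exact h2 i (by omega)

/-- Functions that agree to order `s^K` have the same derivatives of orders below `K`. -/
theorem iteratedDeriv_eq_of_norm_sub_le {G : Type*} [NormedAddCommGroup G] [NormedSpace ℝ G]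
    {g h : ℝ → G} {K : ℕ} {C : ℝ} (hg : ContDiff ℝ (K : WithTop ℕ∞) g)
    (hh : ContDiff ℝ (K : WithTop ℕ∞) h)
    (hC : ∀ s ∈ Icc (0 : ℝ) 1, ‖g s - h s‖ ≤ C * s ^ K) :
    ∀ i < K, iteratedDeriv i g 0 = iteratedDeriv i h 0 := by
  have hd := hg.sub hh
  obtain ⟨D, hD⟩ := isCompact_Icc.exists_bound_of_continuousOn (s := Icc (0 : ℝ) 1)
    (hd.continuous_iteratedDeriv K le_rfl).continuousOn
  have hT := norm_sub_taylor_le hd hD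
  have := eq_zero_of_norm_sum_pow_le (C := C + D) K
    (fun i => ((i.factorial : ℝ)⁻¹) • iteratedDeriv i (fun x => g x - h x) 0) (by
      intro s hs
      have h1 := hT s ⟨hs.1.le, hs.2⟩
      have h2 := hC s ⟨hs.1.le, hs.2⟩
      have e : ∑ i ∈ Finset.range K, (s ^ i / (i.factorial : ℝ)) •
          iteratedDeriv i (fun x => g x - h x) 0 = ∑ i ∈ Finset.range K, s ^ i •
            ((i.factorial : ℝ)⁻¹) • iteratedDeriv i (fun x => g x - h x) 0 :=
        Finset.sum_congr rfl fun i _ => by rw [smul_smul, div_eq_mul_inv]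
      rw [e] at h1
      have h3 := norm_sub_le (g s - h s) ((g s - h s) - ∑ i ∈ Finset.range K, s ^ i •
            ((i.factorial : ℝ)⁻¹) • iteratedDeriv i (fun x => g x - h x) 0)
      rw [sub_sub_cancel] at h3
      linarith)
  intro i hi
  have h1 := this i hi
  rw [smul_eq_zero] at h1
  rcases h1 with h1 | h1
  · simp [Nat.factorial_ne_zero] at h1
  · have h2 := iteratedDeriv_sub (x := (0 : ℝ)) ((hg.of_le (by exact_mod_cast hi.le)).contDiffAt (x := 0))
      ((hh.of_le (by exact_mod_cast hi.le)).contDiffAt (x := 0))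
    rw [← sub_eq_zero, ← h2]
    exact h1

/-- A jointly continuous function of a parameter and of `s ∈ [0, 1]` is close to its values at
the parameter zero, uniformly in `s`. -/
theorem eventually_forall_norm_sub_lt {X G : Type*} [NormedAddCommGroup X]
    [NormedAddCommGroup G] {F : X → ℝ → G} (hF : Continuous fun p : X × ℝ => F p.1 p.2)
    {e : ℝ} (he : 0 < e) :
    ∀ᶠ x in 𝓝 (0 : X), ∀ s ∈ Icc (0 : ℝ) 1, ‖F x s - F 0 s‖ < e := by
  refine isCompact_Icc.eventually_forall_of_forall_eventually fun s _ => ?_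
  have h1 : Continuous fun p : X × ℝ => ‖F p.1 p.2 - F 0 p.2‖ :=
    (hF.sub (hF.comp (by fun_prop : Continuous fun p : X × ℝ => ((0 : X), p.2)))).norm
  exact h1.continuousAt.eventually_lt continuousAt_const (by simpa using he)

theorem eventually_forall_norm_le {X G : Type*} [NormedAddCommGroup X]
    [NormedAddCommGroup G] {F : X → ℝ → G} (hF : Continuous fun p : X × ℝ => F p.1 p.2) :
    ∃ C, 0 ≤ C ∧ ∀ᶠ x in 𝓝 (0 : X), ∀ s ∈ Icc (0 : ℝ) 1, ‖F x s‖ ≤ C := by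
  obtain ⟨D, hD⟩ := isCompact_Icc.exists_bound_of_continuousOn (s := Icc (0 : ℝ) 1)
    (f := fun s => F 0 s) (hF.comp (by fun_prop : Continuous fun s : ℝ => ((0 : X), s))).continuousOn
  refine ⟨D + 1, ?_, ?_⟩
  · have := (norm_nonneg _).trans (hD 0 (by simp)); linarith
  · filter_upwards [eventually_forall_norm_sub_lt hF one_pos] with x hx s hs
    have h1 := hx s hs
    have h2 := hD s hs
    have h3 := norm_le_insert' (F x s) (F 0 s)
    linarith

theorem exists_lipschitzOnWith_closedBall {X G : Type*} [NormedAddCommGroup X] [NormedSpace ℝ X]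
    [FiniteDimensional ℝ X] [NormedAddCommGroup G] [NormedSpace ℝ G] {f : X → G}
    (hf : ContDiff ℝ 1 f) (ρ : ℝ) : ∃ L, LipschitzOnWith L f (Metric.closedBall 0 ρ) := by
  have := FiniteDimensional.proper ℝ X
  obtain ⟨D, hD⟩ := (isCompact_closedBall (0 : X) ρ).exists_bound_of_continuousOn
    (hf.continuous_fderiv (by simp)).continuousOn
  refine ⟨D.toNNReal, (convex_closedBall (0 : X) ρ).lipschitzOnWith_of_nnnorm_fderiv_le
    (fun x _ => hf.differentiable (by simp) x) fun x hx => ?_⟩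
  rw [← NNReal.coe_le_coe, coe_nnnorm]
  exact (hD x hx).trans (Real.le_coe_toNNReal D)

end

/-! ### The total shift and the residual -/

section

open Filter Topology

/-- The polynomial curve `∑ s^j a_j`, as a function of its coefficients and of `s`. -/
def polyCurve {G : Type*} [NormedAddCommGroup G] [NormedSpace ℝ G] (K : ℕ)
    (p : (Fin K → G) × ℝ) : G := ∑ j : Fin K, p.2 ^ (j : ℕ) • p.1 j

theorem contDiff_polyCurve {G : Type*} [NormedAddCommGroup G] [NormedSpace ℝ G] (K : ℕ)
    (N : WithTop ℕ∞) : ContDiff ℝ N (polyCurve (G := G) K) := by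
  unfold polyCurve
  refine ContDiff.sum fun j _ => (contDiff_snd.pow _).smul ?_
  exact (contDiff_apply ℝ G j).comp contDiff_fst

variable {n r : ℕ} (f : Vec n × Vec r → Vec n)

theorem shift_zero (hf0 : f (0, 0) = 0) : ∀ k, shift f 0 k = fun _ => 0 := by
  intro k
  induction k with
  | zero => rfl
  | succ k ih =>
    ext1 s
    simp only [shift, ih, add_zero, hf0]
    have : iteratedDeriv k (fun _ : ℝ => (0 : Vec n)) 0 = 0 := by
      simp
    rw [this]; simp

theorem contDiff_shift (x : Vec n) (N : WithTop ℕ∞) : ∀ k, ContDiff ℝ N (shift f x k) := by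
  intro k
  induction k with
  | zero => exact contDiff_const
  | succ k ih => exact ih.sub (((contDiff_id.pow _).div_const _).smul contDiff_const)

/-- The coefficients of the shifts depend continuously on the target point. -/
theorem exists_shift_coeff {K : ℕ} (hf : ContDiff ℝ (K : WithTop ℕ∞) f) (hf0 : f (0, 0) = 0) :
    ∀ k < K, ∃ a : Vec n → Fin K → Vec n, Continuous a ∧ a 0 = 0 ∧
      ∀ x s, x + shift f x k s = polyCurve K (a x, s) := by
  intro k
  induction k with
  | zero =>
    intro hk
    refine ⟨fun x => Pi.single ⟨0, hk⟩ x,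
      (ContinuousLinearMap.single ℝ (fun _ : Fin K => Vec n) ⟨0, hk⟩).continuous, by simp, fun x s => ?_⟩
    rw [polyCurve, Finset.sum_eq_single ⟨0, hk⟩]
    · simp [shift]
    · intro j _ hj; simp [Pi.single_eq_of_ne hj]
    · simp
  | succ k ih =>
    intro hk
    obtain ⟨a, ha, ha0, hax⟩ := ih (by omega)
    have h1 : ContDiff ℝ ((K - k + k : ℕ) : WithTop ℕ∞)
        fun p : (Fin K → Vec n) × ℝ => f (polyCurve K p, 0) := by
      rw [Nat.sub_add_cancel (by omega)]
      exact hf.comp ((contDiff_polyCurve K _).prodMk contDiff_const)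
    have h2 := (contDiff_iteratedDeriv_param k (K - k) h1).continuous
    set φ : Vec n → Vec n := fun x =>
      -(((k + 1).factorial : ℝ)⁻¹) • iteratedDeriv k (fun σ => f (x + shift f x k σ, 0)) 0 with hφ
    have hφc : Continuous φ := by
      simp only [hφ, hax]
      exact (h2.comp (by fun_prop : Continuous fun x : Vec n => (a x, (0 : ℝ)))).const_smul
        (-(((k + 1).factorial : ℝ)⁻¹))
    have hφ0 : φ 0 = 0 := by
      simp only [hφ, shift_zero f hf0, add_zero, hf0]
      simp
    refine ⟨fun x => a x + Pi.single ⟨k + 1, hk⟩ (φ x),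
      ha.add ((ContinuousLinearMap.single ℝ (fun _ : Fin K => Vec n) ⟨k + 1, hk⟩).continuous.comp hφc),
      by simp [ha0, hφ0], fun x s => ?_⟩
    have e : polyCurve K (a x + Pi.single ⟨k + 1, hk⟩ (φ x), s)
        = polyCurve K (a x, s) + s ^ (k + 1) • φ x := by
      simp only [polyCurve, Pi.add_apply, smul_add, Finset.sum_add_distrib]
      congr 1
      rw [Finset.sum_eq_single ⟨k + 1, hk⟩]
      · simp
      · intro j _ hj; simp [Pi.single_eq_of_ne hj]
      · simp
    rw [e, ← hax]
    simp only [shift, hφ, div_eq_mul_inv, neg_smul, smul_neg, smul_smul]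
    abel

/-- The derivatives of `s^k / k!` at zero. -/
theorem iteratedDeriv_pow_div_factorial_smul {G : Type*} [NormedAddCommGroup G] [NormedSpace ℝ G]
    (k : ℕ) (c : G) : ∀ j, iteratedDeriv j (fun s : ℝ => (s ^ k / (k.factorial : ℝ)) • c) 0
      = if j = k then c else 0 := by
  induction k with
  | zero =>
    intro j
    simp [iteratedDeriv_const]
  | succ k ih =>
    intro j
    rcases j with _ | j
    · simp
    rw [iteratedDeriv_succ']
    have : deriv (fun s : ℝ => (s ^ (k + 1) / ((k + 1).factorial : ℝ)) • c)
        = fun s : ℝ => (s ^ k / (k.factorial : ℝ)) • c := by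
      ext1 s
      have h1 := (((hasDerivAt_pow (k + 1) s).div_const ((k + 1).factorial : ℝ)).smul_const c).deriv
      rw [h1, Nat.factorial_succ]
      congr 1
      push_cast
      field_simp
    rw [this, ih]
    simp

/-- The derivatives of a shift at zero are the negatives of the removed Taylor coefficients. -/
theorem iteratedDeriv_succ_shift (x : Vec n) (i : ℕ) : ∀ k, i < k →
    iteratedDeriv (i + 1) (shift f x k) 0
      = -iteratedDeriv i (fun σ => f (x + shift f x i σ, 0)) 0 := by
  have hz : ∀ k, k ≤ i → iteratedDeriv (i + 1) (shift f x k) 0 = 0 := by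
    intro k
    induction k with
    | zero => intro _; simp [shift]
    | succ k ih =>
      intro hk
      have h1 := iteratedDeriv_sub (n := i + 1) (x := (0 : ℝ))
        ((contDiff_shift f x _ k).contDiffAt)
        (((contDiff_id.pow (k + 1)).div_const ((k + 1).factorial : ℝ)).smul (contDiff_const
          (c := iteratedDeriv k (fun σ => f (x + shift f x k σ, 0)) 0))).contDiffAt
      refine h1.trans ?_
      have h2 := iteratedDeriv_pow_div_factorial_smul (k + 1)
        (iteratedDeriv k (fun σ => f (x + shift f x k σ, 0)) 0) (i + 1)
      rw [if_neg (by omega)] at h2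
      rw [ih (by omega), zero_sub, neg_eq_zero]
      exact h2
  intro k
  induction k with
  | zero => intro h; omega
  | succ k ih =>
    intro hk
    have h1 := iteratedDeriv_sub (n := i + 1) (x := (0 : ℝ))
      ((contDiff_shift f x _ k).contDiffAt)
      (((contDiff_id.pow (k + 1)).div_const ((k + 1).factorial : ℝ)).smul (contDiff_const
        (c := iteratedDeriv k (fun σ => f (x + shift f x k σ, 0)) 0))).contDiffAt
    refine h1.trans ?_
    have h2 := iteratedDeriv_pow_div_factorial_smul (k + 1)
      (iteratedDeriv k (fun σ => f (x + shift f x k σ, 0)) 0) (i + 1)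
    refine (congrArg (fun z => _ - z) h2).trans ?_
    rcases Nat.lt_or_ge i k with h | h
    · rw [ih h, if_neg (by omega), sub_zero]
    · obtain rfl : i = k := by omega
      rw [hz i le_rfl, if_pos rfl, zero_sub]

/-- Later shifts do not change the Taylor coefficients of lower order. -/
theorem iteratedDeriv_comp_shift {K : ℕ} (hf : ContDiff ℝ (K : WithTop ℕ∞) f) (x : Vec n) (i : ℕ) :
    ∀ k, i ≤ k → k ≤ K → iteratedDeriv i (fun σ => f (x + shift f x k σ, 0)) 0
      = iteratedDeriv i (fun σ => f (x + shift f x i σ, 0)) 0 := by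
  intro k hik
  induction k, hik using Nat.le_induction with
  | base => intro _; rfl
  | succ k hik ih =>
    intro hk
    rw [← ih (by omega)]
    have hc : ∀ j, ContDiff ℝ ((k + 1 : ℕ) : WithTop ℕ∞) fun σ => f (x + shift f x j σ, 0) :=
      fun j => (hf.of_le (by exact_mod_cast hk)).comp
        ((contDiff_const.add (contDiff_shift f x _ j)).prodMk contDiff_const)
    have hb : ∀ j, ∃ D, ∀ s ∈ Icc (0 : ℝ) 1, ‖(x + shift f x j s, (0 : Vec r))‖ ≤ D := fun j =>
      isCompact_Icc.exists_bound_of_continuousOn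
        ((continuous_const.add (contDiff_shift f x 0 j).continuous).prodMk
          continuous_const).continuousOn
    obtain ⟨D₁, hD₁⟩ := hb k
    obtain ⟨D₂, hD₂⟩ := hb (k + 1)
    obtain ⟨L, hL⟩ := exists_lipschitzOnWith_closedBall
      (hf.of_le (by exact_mod_cast (by omega : 1 ≤ K))) (max D₁ D₂)
    set c := iteratedDeriv k (fun σ => f (x + shift f x k σ, 0)) 0 with hc'
    refine iteratedDeriv_eq_of_norm_sub_le (K := k + 1)
      (C := L * (‖c‖ / ((k + 1).factorial : ℝ))) (hc _) (hc _) (fun s hs => ?_) i (by omega)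
    have h1 := hL.norm_sub_le (mem_closedBall_zero_iff.2 ((hD₂ s hs).trans (le_max_right _ _)))
      (mem_closedBall_zero_iff.2 ((hD₁ s hs).trans (le_max_left _ _)))
    refine h1.trans (le_of_eq ?_)
    have e : (x + shift f x (k + 1) s, (0 : Vec r)) - (x + shift f x k s, 0)
        = (-((s ^ (k + 1) / ((k + 1).factorial : ℝ)) • c), 0) := by
      ext1
      · simp [shift, hc']
      · simp
    rw [e, Prod.norm_mk, norm_neg, norm_zero, max_eq_left (norm_nonneg _), norm_smul, norm_div,
      norm_pow, Real.norm_eq_abs, abs_of_nonneg hs.1, Real.norm_eq_abs, Nat.abs_cast]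
    ring

/-- The shifts cancel the Taylor coefficients of the residual of the shifted equation. -/
theorem iteratedDeriv_residual {K : ℕ} (hf : ContDiff ℝ (K : WithTop ℕ∞) f) (x : Vec n) (i : ℕ)
    (hi' : i < K - 1) : iteratedDeriv i
      (fun s => f (x + shift f x (K - 1) s, 0) + deriv (shift f x (K - 1)) s) 0 = 0 := by
  have hsc := contDiff_shift f x ((i + 1 : ℕ) : WithTop ℕ∞) (K - 1)
  have hfc : ContDiff ℝ (K : WithTop ℕ∞) fun s => f (x + shift f x (K - 1) s, 0) :=
    hf.comp ((contDiff_const.add (contDiff_shift f x _ _)).prodMk contDiff_const)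
  have h1 := iteratedDeriv_add (n := i) (x := (0 : ℝ))
    ((hfc.of_le (by exact_mod_cast (by omega : i ≤ K))).contDiffAt)
    (g := deriv (shift f x (K - 1)))
    (ContDiff.contDiffAt (by
      have := contDiff_shift f x ((i : WithTop ℕ∞) + 1) (K - 1)
      exact (contDiff_succ_iff_deriv.1 this).2.2))
  have h2 : iteratedDeriv i (deriv (shift f x (K - 1))) 0
      = iteratedDeriv (i + 1) (shift f x (K - 1)) 0 := by
    rw [iteratedDeriv_succ']
  rw [h2, iteratedDeriv_succ_shift f x i (K - 1) hi'] at h1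
  have h3 := iteratedDeriv_comp_shift f hf x i (K - 1) hi'.le (by omega)
  have h4 : iteratedDeriv i (fun s => f (x + shift f x (K - 1) s, 0)) 0
      = iteratedDeriv i (fun σ => f (x + shift f x i σ, 0)) 0 := h3
  rw [h4, add_neg_cancel] at h1
  exact h1

/-- The residual of the shifted equation is of order `s^(4n-1)`, with a small constant. -/
theorem residual_le (hn : 0 < n) (hf : ContDiff ℝ ((4 * n : ℕ) : WithTop ℕ∞) f)
    (hf0 : f (0, 0) = 0) {e : ℝ} (he : 0 < e) :
    ∀ᶠ x in 𝓝 (0 : Vec n), ∀ s ∈ Icc (0 : ℝ) 1,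
      ‖f (x + totalShift f x s, 0) + deriv (totalShift f x) s‖ ≤ e * s ^ (4 * n - 1) := by
  obtain ⟨K, hK⟩ : ∃ K, K = 4 * n := ⟨_, rfl⟩
  have htot : ∀ x, totalShift f x = shift f x (K - 1) := fun x => by rw [hK]; rfl
  rw [← hK] at hf ⊢
  simp only [htot]
  obtain ⟨a, ha, ha0, hax⟩ := exists_shift_coeff f hf hf0 (K - 1) (by omega)
  have hKK : K - 1 + 1 = K := by omega
  have hP1 : ContDiff ℝ (K : WithTop ℕ∞) fun p : (Fin K → Vec n) × ℝ =>
      iteratedDeriv 1 (fun s => polyCurve K (p.1, s)) p.2 :=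
    contDiff_iteratedDeriv_param 1 K (contDiff_polyCurve K _)
  set R : (Fin K → Vec n) × ℝ → Vec n := fun p => f (polyCurve K p, 0)
    + iteratedDeriv 1 (fun s => polyCurve K (p.1, s)) p.2 with hR
  have hRc : ContDiff ℝ (K : WithTop ℕ∞) R :=
    (hf.comp ((contDiff_polyCurve K _).prodMk contDiff_const)).add hP1
  have hdp : ∀ x, deriv (shift f x (K - 1)) = iteratedDeriv 1 (fun s => polyCurve K (a x, s)) := by
    intro x
    rw [iteratedDeriv_one]
    have : (fun s => polyCurve K (a x, s)) = fun s => x + shift f x (K - 1) s :=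
      funext fun s => (hax x s).symm
    rw [this]
    ext1 s
    rw [deriv_const_add]
  have hρ : ∀ x, (fun s => f (x + shift f x (K - 1) s, 0) + deriv (shift f x (K - 1)) s)
      = fun s => R (a x, s) := by
    intro x
    ext1 s
    simp only [hdp, hR, hax]
  clear_value R
  have hder : Continuous fun p : (Fin K → Vec n) × ℝ =>
      iteratedDeriv (K - 1) (fun s => R (p.1, s)) p.2 :=
    (contDiff_iteratedDeriv_param (F := R) (K - 1) 1
      (by rw [Nat.add_comm 1, hKK]; exact hRc)).continuous
  have hder' : Continuous fun p : Vec n × ℝ =>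
      iteratedDeriv (K - 1) (fun s => R (a p.1, s)) p.2 :=
    hder.comp (by fun_prop : Continuous fun p : Vec n × ℝ => (a p.1, p.2))
  have h0 : ∀ s, iteratedDeriv (K - 1) (fun s => R (a 0, s)) s = 0 := by
    intro s
    have h1 : (fun s => R (a 0, s)) = fun _ => 0 := by
      rw [← hρ]
      ext1 s
      rw [shift_zero f hf0]
      simp [hf0]
    rw [h1]; simp
  have htube := eventually_forall_norm_sub_lt
    (F := fun x s => iteratedDeriv (K - 1) (fun s => R (a x, s)) s) hder' he
  filter_upwards [htube] with x hx s hs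
  have hRx : ContDiff ℝ (K : WithTop ℕ∞) fun s => R (a x, s) :=
    hRc.comp (contDiff_const.prodMk contDiff_id)
  have hT := norm_sub_taylor_le (N := K - 1) (C := e)
    (hRx.of_le (by exact_mod_cast Nat.sub_le _ _))
    (fun s hs => by have := (hx s hs).le; rwa [h0, sub_zero] at this) s hs
  have hvan : ∀ i ∈ Finset.range (K - 1),
      (s ^ i / (i.factorial : ℝ)) • iteratedDeriv i (fun s => R (a x, s)) 0 = 0 := by
    intro i hi
    rw [← hρ, iteratedDeriv_residual f hf x i (Finset.mem_range.1 hi), smul_zero]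
  rw [Finset.sum_eq_zero hvan, sub_zero] at hT
  rw [show f (x + shift f x (K - 1) s, 0) + deriv (shift f x (K - 1)) s = R (a x, s) from
    congrFun (hρ x) s]
  exact hT

/-- The `i`-th Taylor coefficient at `s = 0` of `H` along the total shift, times `i!`. -/
def alongCoeff {G : Type*} [NormedAddCommGroup G] [NormedSpace ℝ G] (H : Vec n → G) (i : ℕ)
    (x : Vec n) : G := iteratedDeriv i (fun σ : ℝ => H (x + totalShift f x σ)) 0

theorem continuous_alongCoeff {G : Type*} [NormedAddCommGroup G] [NormedSpace ℝ G] (hn : 0 < n)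
    (hf : ContDiff ℝ ((4 * n : ℕ) : WithTop ℕ∞) f) (hf0 : f (0, 0) = 0) {H : Vec n → G} {N : ℕ}
    (hH : ContDiff ℝ (N : WithTop ℕ∞) H) {i : ℕ} (hi : i ≤ N) :
    Continuous fun x => alongCoeff f H i x := by
  obtain ⟨a, ha, -, hax⟩ := exists_shift_coeff f hf hf0 (4 * n - 1) (by omega)
  have h1 := (contDiff_iteratedDeriv_param (F := fun p => H (polyCurve (4 * n) p)) i (N - i) (by
    rw [Nat.sub_add_cancel hi]; exact hH.comp (contDiff_polyCurve _ _))).continuous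
  simp only [alongCoeff, totalShift, hax]
  exact h1.comp (by fun_prop : Continuous fun x : Vec n => (a x, (0 : ℝ)))

theorem alongCoeff_zero {G : Type*} [NormedAddCommGroup G] [NormedSpace ℝ G]
    (hf0 : f (0, 0) = 0) (H : Vec n → G) (i : ℕ) :
    alongCoeff f H i 0 = if i = 0 then H 0 else 0 := by
  rw [alongCoeff, totalShift, shift_zero f hf0]
  simp [iteratedDeriv_const]

theorem norm_sub_along_le {G : Type*} [NormedAddCommGroup G] [NormedSpace ℝ G] (hn : 0 < n)
    (hf : ContDiff ℝ ((4 * n : ℕ) : WithTop ℕ∞) f) (hf0 : f (0, 0) = 0) {H : Vec n → G} {N : ℕ}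
    (hH : ContDiff ℝ (N : WithTop ℕ∞) H) :
    ∃ C, 0 ≤ C ∧ ∀ᶠ x in 𝓝 (0 : Vec n), ∀ s ∈ Icc (0 : ℝ) 1,
      ‖H (x + totalShift f x s)
        - ∑ i ∈ Finset.range N, (s ^ i / (i.factorial : ℝ)) • alongCoeff f H i x‖ ≤ C * s ^ N := by
  obtain ⟨a, ha, -, hax⟩ := exists_shift_coeff f hf hf0 (4 * n - 1) (by omega)
  have h1 := (contDiff_iteratedDeriv_param (F := fun p => H (polyCurve (4 * n) p)) N 0 (by
    rw [zero_add]; exact hH.comp (contDiff_polyCurve _ _))).continuous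
  have h2 : Continuous fun p : Vec n × ℝ =>
      iteratedDeriv N (fun s => H (polyCurve (4 * n) (a p.1, s))) p.2 :=
    h1.comp (by fun_prop : Continuous fun p : Vec n × ℝ => (a p.1, p.2))
  obtain ⟨C, hC0, hC⟩ := eventually_forall_norm_le
    (F := fun x s => iteratedDeriv N (fun s => H (polyCurve (4 * n) (a x, s))) s) h2
  refine ⟨C, hC0, ?_⟩
  filter_upwards [hC] with x hx
  have hax' : ∀ s, polyCurve (4 * n) (a x, s) = x + totalShift f x s := fun s => (hax x s).symm
  simp only [hax'] at hx
  exact norm_sub_taylor_le (hH.comp (contDiff_const.add (contDiff_shift f x _ _))) hx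

/-- The total shift is uniformly small for small targets. -/
theorem eventually_norm_totalShift_lt (hn : 0 < n)
    (hf : ContDiff ℝ ((4 * n : ℕ) : WithTop ℕ∞) f) (hf0 : f (0, 0) = 0) {e : ℝ} (he : 0 < e) :
    ∀ᶠ x in 𝓝 (0 : Vec n), ∀ s ∈ Icc (0 : ℝ) 1, ‖x + totalShift f x s‖ < e := by
  obtain ⟨a, ha, ha0, hax⟩ := exists_shift_coeff f hf hf0 (4 * n - 1) (by omega)
  have h1 : Continuous fun p : Vec n × ℝ => polyCurve (4 * n) (a p.1, p.2) :=
    (contDiff_polyCurve (4 * n) 0).continuous.comp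
      (by fun_prop : Continuous fun p : Vec n × ℝ => (a p.1, p.2))
  filter_upwards [eventually_forall_norm_sub_lt (F := fun x s => polyCurve (4 * n) (a x, s)) h1 he]
    with x hx s hs
  have h2 := hx s hs
  have h3 : polyCurve (4 * n) (a 0, s) = 0 := by simp [ha0, polyCurve]
  rwa [h3, sub_zero, ← hax] at h2

end

/-! ### The controllability sequence and the Kalman condition -/

section

open Filter Topology
open ContinuousLinearMap (adjoint)

/-- The controllability sequence `Q_0 = Q`, `Q_(k+1) = Q_k' + P Q_k` of the time-varying system
`dc/ds = -(P c + Q d)`; for constant coefficients it is `A^k B`. -/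
def ctrlSeq {E U : Type*} [NormedAddCommGroup E] [NormedSpace ℝ E] [NormedAddCommGroup U]
    [NormedSpace ℝ U] (P : ℝ → E →L[ℝ] E) (Q : ℝ → U →L[ℝ] E) : ℕ → ℝ → U →L[ℝ] E
  | 0 => Q
  | k + 1 => fun s => deriv (ctrlSeq P Q k) s + (P s).comp (ctrlSeq P Q k s)

section
variable {E U : Type*} [NormedAddCommGroup E] [NormedSpace ℝ E] [NormedAddCommGroup U]
    [NormedSpace ℝ U]

theorem contDiff_ctrlSeq {X : Type*} [NormedAddCommGroup X] [NormedSpace ℝ X]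
    {P : X × ℝ → E →L[ℝ] E} {Q : X × ℝ → U →L[ℝ] E}
    (hP : ∀ N : ℕ, ContDiff ℝ (N : WithTop ℕ∞) P) (hQ : ∀ N : ℕ, ContDiff ℝ (N : WithTop ℕ∞) Q)
    (k : ℕ) : ∀ N : ℕ, ContDiff ℝ (N : WithTop ℕ∞) fun p : X × ℝ =>
      ctrlSeq (fun s => P (p.1, s)) (fun s => Q (p.1, s)) k p.2 := by
  induction k with
  | zero => exact hQ
  | succ k ih =>
    intro N
    have h1 := contDiff_iteratedDeriv_param 1 N (ih (N + 1))
    simp only [iteratedDeriv_one] at h1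
    exact h1.add ((hP N).clm_comp (ih N))

theorem hasDerivAt_ctrlSeq {P : ℝ → E →L[ℝ] E} {Q : ℝ → U →L[ℝ] E} {k : ℕ}
    (h : Differentiable ℝ (ctrlSeq P Q k)) (s : ℝ) :
    HasDerivAt (ctrlSeq P Q k) (ctrlSeq P Q (k + 1) s - (P s).comp (ctrlSeq P Q k s)) s := by
  simpa [ctrlSeq] using (h s).hasDerivAt

theorem ctrlSeq_const (A : E →L[ℝ] E) (B : U →L[ℝ] E) (k : ℕ) :
    ctrlSeq (fun _ => A) (fun _ => B) k = fun _ => (A ^ k).comp B := by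
  induction k with
  | zero => ext; simp [ctrlSeq]
  | succ k ih =>
    ext1 s
    simp only [ctrlSeq, ih, deriv_const, zero_add]
    rw [pow_succ']
    rfl

end

theorem apply_eq_sum {a b : ℕ} (T : Vec a →L[ℝ] Vec b) (v : Vec a) (i : Fin b) :
    T v i = ∑ l, T (EuclideanSpace.single l 1) i * v l := by
  have hv : v = ∑ l, v l • EuclideanSpace.single l (1 : ℝ) := by
    ext j
    simp [Pi.single_apply]
  conv_lhs => rw [hv]
  simp [mul_comm]

variable {n r : ℕ} (f : Vec n × Vec r → Vec n)

theorem pow_comp_single (k : ℕ) (i : Fin n) (j : Fin r) :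
    (((partialX f 0) ^ k).comp (partialU f 0)) (EuclideanSpace.single j 1) i
      = (matA f ^ k * matB f) i j := by
  induction k generalizing i with
  | zero => simp [partialU, matB]
  | succ k ih =>
    rw [pow_succ', pow_succ', Matrix.mul_assoc, Matrix.mul_apply]
    change (partialX f 0) ((((partialX f 0) ^ k).comp (partialU f 0))
      (EuclideanSpace.single j 1)) i = _
    rw [apply_eq_sum]
    refine Finset.sum_congr rfl fun l _ => ?_
    rw [ih l]
    rfl

/-- The Kalman condition in terms of the adjoints of `A^k B`. -/
theorem exists_adjoint_ne_zero (hrank : (kalmanMatrix (matA f) (matB f)).rank = n) {η : Vec n}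
    (hη : η ≠ 0) : ∃ k < n, adjoint (((partialX f 0) ^ k).comp (partialU f 0)) η ≠ 0 := by
  by_contra! hcon
  apply hη
  have hrow : LinearIndependent ℝ (kalmanMatrix (matA f) (matB f)).row := by
    rw [linearIndependent_iff_card_eq_finrank_span, Fintype.card_fin, Set.finrank,
      ← Matrix.rank_eq_finrank_span_row, hrank]
  have hinj := Matrix.vecMul_injective_iff.2 hrow
  have h0 : Matrix.vecMul (fun i => η i) (kalmanMatrix (matA f) (matB f)) = 0 := by
    ext ⟨k, j⟩
    have h1 := hcon k k.2
    have h2 : inner ℝ η ((((partialX f 0) ^ (k : ℕ)).comp (partialU f 0))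
        (EuclideanSpace.single j 1)) = 0 := by
      rw [← ContinuousLinearMap.adjoint_inner_left, h1, inner_zero_left]
    rw [PiLp.inner_apply] at h2
    rw [Matrix.vecMul, dotProduct, Pi.zero_apply, ← h2]
    refine Finset.sum_congr rfl fun i _ => ?_
    rw [pow_comp_single]
    simp [kalmanMatrix, mul_comm]
  have h3 := hinj (h0.trans (Matrix.zero_vecMul _).symm)
  ext i
  exact congrFun h3 i

/-- The sum of the terms of orders below `N` of the Taylor expansion of `H` along the total
shift. -/
def alongPoly {G : Type*} [NormedAddCommGroup G] [NormedSpace ℝ G] (H : Vec n → G) (N : ℕ)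
    (x : Vec n) (s : ℝ) : G :=
  ∑ i ∈ Finset.range N, (s ^ i / (i.factorial : ℝ)) • alongCoeff f H i x

theorem alongPoly_eq {G : Type*} [NormedAddCommGroup G] [NormedSpace ℝ G] (H : Vec n → G) (N : ℕ)
    (x : Vec n) (s : ℝ) : alongPoly f H N x s
      = polyCurve N (fun i : Fin N => (((i : ℕ).factorial : ℝ)⁻¹) • alongCoeff f H i x, s) := by
  rw [alongPoly, polyCurve, Finset.sum_range]
  exact Finset.sum_congr rfl fun i _ => by rw [smul_smul, div_eq_mul_inv]

theorem alongPoly_zero {G : Type*} [NormedAddCommGroup G] [NormedSpace ℝ G]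
    (hf0 : f (0, 0) = 0) (H : Vec n → G) {N : ℕ} (hN : 0 < N) (s : ℝ) :
    alongPoly f H N 0 s = H 0 := by
  rw [alongPoly, Finset.sum_eq_single 0]
  · simp [alongCoeff_zero f hf0]
  · intro i _ hi; simp [alongCoeff_zero f hf0, hi]
  · intro h; exact absurd (Finset.mem_range.2 hN) h

/-- The coefficient of the state in the linear part of the shifted system, as a function of
`s = e^{-τ}`. -/
def stateCoeff (x : Vec n) : ℝ → Vec n →L[ℝ] Vec n := alongPoly f (partialX f) n x

/-- The coefficient of the control in the linear part of the shifted system, as a function of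
`s = e^{-τ}`. -/
def inputCoeff (x : Vec n) : ℝ → Vec r →L[ℝ] Vec n := alongPoly f (partialU f) (2 * n) x

theorem contDiff_partialX {N : ℕ} (hf : ContDiff ℝ ((N + 1 : ℕ) : WithTop ℕ∞) f) :
    ContDiff ℝ (N : WithTop ℕ∞) (partialX f) := by
  unfold partialX
  exact ((hf.fderiv_right (by norm_cast)).comp (contDiff_id.prodMk contDiff_const)).clm_comp
    contDiff_const

theorem contDiff_partialU {N : ℕ} (hf : ContDiff ℝ ((N + 1 : ℕ) : WithTop ℕ∞) f) :
    ContDiff ℝ (N : WithTop ℕ∞) (partialU f) := by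
  unfold partialU
  exact ((hf.fderiv_right (by norm_cast)).comp (contDiff_id.prodMk contDiff_const)).clm_comp
    contDiff_const

theorem contDiff_alongPoly {G : Type*} [NormedAddCommGroup G] [NormedSpace ℝ G] (H : Vec n → G)
    (N : ℕ) (x : Vec n) (M : WithTop ℕ∞) : ContDiff ℝ M (alongPoly f H N x) := by
  unfold alongPoly
  exact ContDiff.sum fun i _ => ((contDiff_id.pow _).div_const _).smul contDiff_const

theorem continuous_ctrlSeq (hn : 0 < n) (hf : ContDiff ℝ ((4 * n : ℕ) : WithTop ℕ∞) f)
    (hf0 : f (0, 0) = 0) (k : ℕ) : Continuous fun p : Vec n × ℝ =>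
      ctrlSeq (stateCoeff f p.1) (inputCoeff f p.1) k p.2 := by
  have hf' : ContDiff ℝ ((4 * n - 1 + 1 : ℕ) : WithTop ℕ∞) f := by
    rwa [Nat.sub_add_cancel (by omega)]
  -- the coefficients of the polynomials are the parameters
  let X := (Fin n → Vec n →L[ℝ] Vec n) × (Fin (2 * n) → Vec r →L[ℝ] Vec n)
  have h1 := (contDiff_ctrlSeq (X := X) (P := fun p => polyCurve n (p.1.1, p.2))
    (Q := fun p => polyCurve (2 * n) (p.1.2, p.2))
    (fun N => (contDiff_polyCurve n N).comp
      ((contDiff_fst.comp contDiff_fst).prodMk contDiff_snd))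
    (fun N => (contDiff_polyCurve (2 * n) N).comp
      ((contDiff_snd.comp contDiff_fst).prodMk contDiff_snd)) k 0).continuous
  have hP : ∀ i : Fin n, Continuous fun x => (((i : ℕ).factorial : ℝ)⁻¹) •
      alongCoeff f (partialX f) i x := fun i =>
    (continuous_alongCoeff f (i := i) hn hf hf0 (contDiff_partialX f hf')
      (by have := i.2; omega)).const_smul (((i : ℕ).factorial : ℝ)⁻¹)
  have hQ : ∀ i : Fin (2 * n), Continuous fun x => (((i : ℕ).factorial : ℝ)⁻¹) •
      alongCoeff f (partialU f) i x := fun i =>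
    (continuous_alongCoeff f (i := i) hn hf hf0 (contDiff_partialU f hf')
      (by have := i.2; omega)).const_smul (((i : ℕ).factorial : ℝ)⁻¹)
  have h2 : Continuous fun p : Vec n × ℝ =>
      (((fun i : Fin n => (((i : ℕ).factorial : ℝ)⁻¹) • alongCoeff f (partialX f) i p.1,
        fun i : Fin (2 * n) => (((i : ℕ).factorial : ℝ)⁻¹) • alongCoeff f (partialU f) i p.1) : X),
          p.2) :=
    (((continuous_pi hP).prodMk (continuous_pi hQ)).comp continuous_fst).prodMk continuous_snd
  have h3 := h1.comp h2
  have e1 : ∀ x, stateCoeff f x = fun s => polyCurve n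
      (fun i : Fin n => (((i : ℕ).factorial : ℝ)⁻¹) • alongCoeff f (partialX f) i x, s) :=
    fun x => funext fun s => alongPoly_eq f _ _ x s
  have e2 : ∀ x, inputCoeff f x = fun s => polyCurve (2 * n)
      (fun i : Fin (2 * n) => (((i : ℕ).factorial : ℝ)⁻¹) • alongCoeff f (partialU f) i x, s) :=
    fun x => funext fun s => alongPoly_eq f _ _ x s
  simp only [e1, e2]
  exact h3

theorem differentiable_ctrlSeq (x : Vec n) (k : ℕ) :
    Differentiable ℝ (ctrlSeq (stateCoeff f x) (inputCoeff f x) k) := by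
  have h := contDiff_ctrlSeq (X := ℝ) (P := fun p => stateCoeff f x p.2)
    (Q := fun p => inputCoeff f x p.2)
    (fun N => (contDiff_alongPoly f _ _ x _).comp contDiff_snd)
    (fun N => (contDiff_alongPoly f _ _ x _).comp contDiff_snd) k 1
  have h2 := h.comp (contDiff_const (c := (0 : ℝ)) |>.prodMk contDiff_id)
  exact h2.differentiable (by simp)

/-- For small targets, the controllability sequence is bounded and satisfies the Kalman condition
uniformly in `s ∈ [0, 1]`. -/
theorem eventually_ctrlSeq_bounds (hn : 0 < n) (hf : ContDiff ℝ ((4 * n : ℕ) : WithTop ℕ∞) f)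
    (hf0 : f (0, 0) = 0) (hrank : (kalmanMatrix (matA f) (matB f)).rank = n) :
    ∃ c > 0, ∃ b, 0 ≤ b ∧ ∀ᶠ x in 𝓝 (0 : Vec n), ∀ s ∈ Icc (0 : ℝ) 1,
      (∀ k ≤ n, ‖ctrlSeq (stateCoeff f x) (inputCoeff f x) k s‖ ≤ b) ∧
      ∀ η, c * ‖η‖ ^ 2 ≤ ∑ k ∈ Finset.range n,
        ‖adjoint (ctrlSeq (stateCoeff f x) (inputCoeff f x) k s) η‖ ^ 2 := by
  set T : ℕ → Vec r →L[ℝ] Vec n := fun k => ((partialX f 0) ^ k).comp (partialU f 0) with hT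
  obtain ⟨c, hc, hcT⟩ := exists_pos_mul_sq_norm_le
    (fun η : Vec n => ∑ k ∈ Finset.range n, ‖adjoint (T k) η‖ ^ 2) (by fun_prop)
    (fun a x => by
      simp only [map_smul, norm_smul, mul_pow, Real.norm_eq_abs, sq_abs, Finset.mul_sum])
    (fun η hη => by
      obtain ⟨k, hk, hne⟩ := exists_adjoint_ne_zero f hrank hη
      refine Finset.sum_pos' (fun _ _ => by positivity) ⟨k, Finset.mem_range.2 hk, ?_⟩
      have := norm_pos_iff.2 hne
      positivity)
  have h0 : ∀ k s, ctrlSeq (stateCoeff f 0) (inputCoeff f 0) k s = T k := by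
    intro k s
    have e1 : stateCoeff f 0 = fun _ => partialX f 0 :=
      funext fun s => alongPoly_zero f hf0 _ hn s
    have e2 : inputCoeff f 0 = fun _ => partialU f 0 :=
      funext fun s => alongPoly_zero f hf0 _ (by omega) s
    rw [e1, e2, ctrlSeq_const]
  -- a perturbation of size `d` of each term leaves a quarter of the constant
  set d : ℝ := Real.sqrt (c / (4 * n)) with hd
  have hn' : (0 : ℝ) < n := by exact_mod_cast hn
  have hd0 : 0 < d := by positivity
  have hd2 : d ^ 2 = c / (4 * n) := Real.sq_sqrt (by positivity)
  have hev : ∀ᶠ x in 𝓝 (0 : Vec n), ∀ k ∈ Finset.range (n + 1), ∀ s ∈ Icc (0 : ℝ) 1,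
      ‖ctrlSeq (stateCoeff f x) (inputCoeff f x) k s - T k‖ < d := by
    rw [Filter.eventually_all_finset]
    intro k _
    have := eventually_forall_norm_sub_lt
      (F := fun x s => ctrlSeq (stateCoeff f x) (inputCoeff f x) k s)
      (continuous_ctrlSeq f hn hf hf0 k) hd0
    simpa only [h0] using this
  refine ⟨c / 4, by positivity, ∑ k ∈ Finset.range (n + 1), ‖T k‖ + d, by positivity, ?_⟩
  filter_upwards [hev] with x hx s hs
  refine ⟨fun k hk => ?_, fun η => ?_⟩
  · have hk' := Finset.mem_range.2 (Nat.lt_succ_of_le hk)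
    have h1 := (hx k hk' s hs).le
    have h2 := norm_le_insert' (ctrlSeq (stateCoeff f x) (inputCoeff f x) k s) (T k)
    have h3 : ‖T k‖ ≤ ∑ k ∈ Finset.range (n + 1), ‖T k‖ :=
      Finset.single_le_sum (f := fun k => ‖T k‖) (fun i _ => norm_nonneg _) hk'
    linarith
  · have h1 : ∀ k ∈ Finset.range n, 1 / 2 * ‖adjoint (T k) η‖ ^ 2 - d ^ 2 * ‖η‖ ^ 2
        ≤ ‖adjoint (ctrlSeq (stateCoeff f x) (inputCoeff f x) k s) η‖ ^ 2 := by
      intro k hk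
      set S := ctrlSeq (stateCoeff f x) (inputCoeff f x) k s with hS
      have h2 : ‖S - T k‖ ≤ d :=
        (hx k (Finset.mem_range.2 (by have := Finset.mem_range.1 hk; omega)) s hs).le
      have h3 : ‖adjoint S η - adjoint (T k) η‖ ≤ d * ‖η‖ := by
        rw [← sub_apply, ← map_sub]
        refine ((adjoint (S - T k)).le_opNorm η).trans ?_
        rw [LinearIsometryEquiv.norm_map]
        gcongr
      have h4 : ‖adjoint (T k) η‖ ≤ ‖adjoint S η‖ + d * ‖η‖ := by
        have := norm_le_insert (adjoint S η) (adjoint (T k) η)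
        linarith
      have h5 : ‖adjoint (T k) η‖ ^ 2 ≤ (‖adjoint S η‖ + d * ‖η‖) ^ 2 := by gcongr
      nlinarith [sq_nonneg (‖adjoint S η‖ - d * ‖η‖)]
    refine le_trans ?_ (Finset.sum_le_sum h1)
    rw [Finset.sum_sub_distrib, ← Finset.mul_sum, Finset.sum_const, Finset.card_range,
      nsmul_eq_mul, hd2]
    have h6 := hcT η
    have h7 : (n : ℝ) * (c / (4 * n) * ‖η‖ ^ 2) = c / 4 * ‖η‖ ^ 2 := by field_simp
    rw [h7]
    linarith

end

/-! ### Cutoff and the return to finite time -/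

section

open Filter Topology
open ContinuousLinearMap (adjoint)

/-- A function of class `C^2` agrees near the unit ball with one that is globally Lipschitz
together with its derivative. -/
theorem exists_lipschitz_cutoff {X G : Type*} [NormedAddCommGroup X] [NormedSpace ℝ X]
    [FiniteDimensional ℝ X] [NormedAddCommGroup G] [NormedSpace ℝ G] {f : X → G}
    (hf : ContDiff ℝ 2 f) : ∃ F : X → G, ContDiff ℝ 2 F ∧ (∀ z ∈ Metric.ball (0 : X) 1, F z = f z) ∧
      (∃ L, LipschitzWith L F) ∧ ∃ L, LipschitzWith L (fderiv ℝ F) := by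
  let χ : ContDiffBump (0 : X) := ⟨1, 2, one_pos, one_lt_two⟩
  have hF : ContDiff ℝ 2 fun z => χ z • f z := χ.contDiff.smul hf
  have hs : HasCompactSupport fun z => χ z • f z := χ.hasCompactSupport.smul_right
  refine ⟨fun z => χ z • f z, hF, fun z hz => ?_, ?_, ?_⟩
  · have : χ z = 1 := χ.one_of_mem_closedBall (Metric.ball_subset_closedBall hz)
    simp [this]
  · exact ContDiff.lipschitzWith_of_hasCompactSupport hs hF (by simp)
  · exact ContDiff.lipschitzWith_of_hasCompactSupport (n := 1) (hs.fderiv ℝ)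
      (hF.fderiv_right (by norm_num)) (by simp)

theorem norm_sub_fderiv_le {X G : Type*} [NormedAddCommGroup X] [NormedSpace ℝ X]
    [NormedAddCommGroup G] [NormedSpace ℝ G] {F : X → G} (hF : Differentiable ℝ F) {L : NNReal}
    (hL : LipschitzWith L (fderiv ℝ F)) (z h : X) :
    ‖F (z + h) - F z - fderiv ℝ F z h‖ ≤ L * ‖h‖ ^ 2 := by
  have h1 := (convex_closedBall z ‖h‖).norm_image_sub_le_of_norm_fderiv_le' (f := F)
    (φ := fderiv ℝ F z) (C := L * ‖h‖) (x := z) (y := z + h) (fun x _ => hF x)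
    (fun x hx => ?_) (by simp) (by simp)
  · rw [add_sub_cancel_left] at h1
    exact h1.trans (le_of_eq (by ring))
  · refine (hL.norm_sub_le x z).trans ?_
    gcongr
    exact mem_closedBall_iff_norm.1 hx

/-- A solution in the variable `τ ∈ [0, ∞)` that vanishes at infinity gives, by the substitution
`t = 1 - e^{-τ}`, a solution on `[0, 1]`. -/
theorem exists_isSolution {n r : ℕ} {f : Vec n × Vec r → Vec n} (hf : Continuous f) {N : ℝ}
    (hN : 0 < N) {x₁ : Vec n} {p y : ℝ → Vec n} {d : ℝ → Vec r} (hp : ContDiff ℝ 1 p)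
    (hp0 : p 0 = 0) (hy0 : y 0 = -x₁ - p 1)
    (hy : ∀ τ, 0 ≤ τ → HasDerivWithinAt y (Real.exp (-τ) • (f (x₁ + p (Real.exp (-τ)) + y τ, d τ)
      + deriv p (Real.exp (-τ)))) (Ici 0) τ)
    (hd : ContinuousOn d (Ici 0)) (hdN : ∀ τ, 0 ≤ τ → ‖d τ‖ < N)
    (hytop : Tendsto y atTop (𝓝 0)) (hdtop : Tendsto d atTop (𝓝 0)) :
    ∃ (x : ℝ → Vec n) (u : ℝ → Vec r),
      (∀ τ, 0 ≤ τ → x (1 - Real.exp (-τ)) = x₁ + p (Real.exp (-τ)) + y τ ∧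
        u (1 - Real.exp (-τ)) = d τ) ∧ IsSolution f N x₁ x u := by
  set l : ℝ → ℝ := fun t => -Real.log (1 - t) with hl
  set X : ℝ → Vec n := fun t => x₁ + p (1 - t) + y (l t) with hX
  set x : ℝ → Vec n := fun t => if t < 1 then X t else x₁ with hx
  set u : ℝ → Vec r := fun t => if t < 1 then d (l t) else 0 with hu
  have hx1 : x 1 = x₁ := by simp [hx]
  have hu1 : u 1 = 0 := by simp [hu]
  have hxX : ∀ t, t < 1 → x t = X t := fun t ht => by simp [hx, ht]
  have hud : ∀ t, t < 1 → u t = d (l t) := fun t ht => by simp [hu, ht]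
  have hl0 : ∀ t ∈ Icc (0 : ℝ) 1, 0 ≤ l t := fun t ht => by
    have := Real.log_nonpos (x := 1 - t) (by linarith [ht.2]) (by linarith [ht.1])
    simp only [hl]; linarith
  have hexpl : ∀ t, t < 1 → Real.exp (-l t) = 1 - t := fun t ht => by
    simp only [hl, neg_neg]; exact Real.exp_log (by linarith)
  have hld : ∀ t, t < 1 → HasDerivAt l (1 - t)⁻¹ t := fun t ht => by
    have h1 : HasDerivAt (fun t : ℝ => 1 - t) (-1) t := by
      simpa using (hasDerivAt_id t).const_sub 1
    have h2 := (h1.log (by linarith : (1 : ℝ) - t ≠ 0)).neg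
    refine h2.congr_deriv ?_
    rw [neg_div, neg_neg, one_div]
  have hltop : Tendsto l (𝓝[<] 1) atTop := by
    have h1 : Tendsto (fun t : ℝ => 1 - t) (𝓝[<] 1) (𝓝[>] 0) := by
      refine tendsto_nhdsWithin_iff.2 ⟨?_, ?_⟩
      · have : Tendsto (fun t : ℝ => 1 - t) (𝓝 1) (𝓝 (1 - 1)) := by
          exact (continuous_const.sub continuous_id).tendsto 1
        rw [sub_self] at this
        exact this.mono_left nhdsWithin_le_nhds
      · filter_upwards [self_mem_nhdsWithin] with t ht
        exact mem_Ioi.2 (sub_pos.2 (mem_Iio.1 ht))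
    exact tendsto_neg_atBot_atTop.comp (Real.tendsto_log_nhdsGT_zero.comp h1)
  have hXtop : Tendsto x (𝓝[<] 1) (𝓝 x₁) := by
    have h1 : Tendsto (fun t : ℝ => p (1 - t)) (𝓝[<] 1) (𝓝 (p (1 - 1))) :=
      ((hp.continuous.comp (continuous_const.sub continuous_id)).tendsto 1).mono_left
        nhdsWithin_le_nhds
    have h2 := (h1.const_add x₁).add (hytop.comp hltop)
    rw [sub_self, hp0, add_zero, add_zero] at h2
    refine h2.congr' ?_
    filter_upwards [self_mem_nhdsWithin] with t ht
    exact (hxX t ht).symm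
  have hutop : Tendsto u (𝓝[<] 1) (𝓝 0) := by
    refine (hdtop.comp hltop).congr' ?_
    filter_upwards [self_mem_nhdsWithin] with t ht
    exact (hud t ht).symm
  have hcont1 : ∀ {G : Type} [TopologicalSpace G] (g : ℝ → G), Tendsto g (𝓝[<] 1) (𝓝 (g 1)) →
      ContinuousWithinAt g (Icc 0 1) 1 := by
    intro G _ g hg
    rw [← Ico_insert_right zero_le_one, continuousWithinAt_insert_self]
    exact hg.mono_left (nhdsWithin_mono _ fun t ht => ht.2)
  have hode : ∀ t ∈ Ico (0 : ℝ) 1, HasDerivWithinAt x (f (x t, u t)) (Icc 0 1) t := by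
    intro t ht
    have htI : t ∈ Icc (0 : ℝ) 1 := ⟨ht.1, ht.2.le⟩
    have h1 := (hy (l t) (hl0 t htI)).scomp t (hld t ht.2).hasDerivWithinAt (s := Icc 0 1) hl0
    rw [hexpl t ht.2] at h1
    have h2 : HasDerivAt (fun t : ℝ => 1 - t) (-1) t := by
      simpa using (hasDerivAt_id t).const_sub 1
    have h3 : HasDerivAt p (deriv p (1 - t)) (1 - t) :=
      (hp.differentiable (by simp) _).hasDerivAt
    have h4 := ((h3.scomp t h2).const_add x₁).hasDerivWithinAt (s := Icc 0 1) |>.add h1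
    have hne : (1 - t) ≠ 0 := by linarith [ht.2]
    have h5 : HasDerivWithinAt X (f (x t, u t)) (Icc 0 1) t := by
      refine HasDerivWithinAt.congr_deriv h4 ?_
      rw [smul_smul, inv_mul_cancel₀ hne, one_smul, hxX t ht.2, hud t ht.2]
      simp [hX]
    refine h5.congr_of_eventuallyEq ?_ (hxX t ht.2)
    filter_upwards [nhdsWithin_le_nhds (Iio_mem_nhds ht.2)] with s hs using hxX s hs
  have hxc : ContinuousOn x (Icc 0 1) := by
    intro t ht
    rcases ht.2.lt_or_eq with h | rfl
    · exact (hode t ⟨ht.1, h⟩).continuousWithinAt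
    · exact hcont1 x (by rw [hx1]; exact hXtop)
  have huc : ContinuousOn u (Icc 0 1) := by
    intro t ht
    rcases ht.2.lt_or_eq with h | rfl
    · have h1 : ContinuousWithinAt (fun t => d (l t)) (Icc 0 1) t :=
        (hd (l t) (hl0 t ht)).comp (hld t h).continuousAt.continuousWithinAt hl0
      refine h1.congr_of_eventuallyEq ?_ (hud t h)
      filter_upwards [nhdsWithin_le_nhds (Iio_mem_nhds h)] with s hs using hud s hs
    · exact hcont1 u (by rw [hu1]; exact hutop)
  refine ⟨x, u, fun τ hτ => ?_, hxc, huc, fun t ht => ?_, fun t ht => ?_, ?_, hx1⟩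
  · have h1 : 1 - Real.exp (-τ) < 1 := by linarith [Real.exp_pos (-τ)]
    rw [hxX _ h1, hud _ h1]
    simp [hX, hl]
  · rcases ht.2.lt_or_eq with h | rfl
    · exact hode t ⟨ht.1, h⟩
    · have hat : ∀ t ∈ Ioo (0 : ℝ) 1, HasDerivAt x (f (x t, u t)) t := fun t ht =>
        (hode t ⟨ht.1.le, ht.2⟩).hasDerivAt (Icc_mem_nhds ht.1 ht.2)
      have hmem : Ioo (0 : ℝ) 1 ∈ 𝓝[<] (1 : ℝ) := Ioo_mem_nhdsLT one_pos
      refine (hasDerivWithinAt_Iic_of_tendsto_deriv (s := Ioo 0 1)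
        (fun t ht => (hat t ht).differentiableAt.differentiableWithinAt)
        ((hxc 1 (by simp)).mono Ioo_subset_Icc_self) hmem ?_).mono Icc_subset_Iic_self
      rw [hx1, hu1]
      refine ((hf.tendsto (x₁, 0)).comp (hXtop.prodMk_nhds hutop)).congr' ?_
      filter_upwards [hmem] with t ht using (hat t ht).deriv.symm
  · rcases ht.2.lt_or_eq with h | rfl
    · rw [hud t h]; exact hdN _ (hl0 t ht)
    · rw [hu1, norm_zero]; exact hN
  · rw [hxX 0 one_pos]
    simp [hX, hl, hy0]

end

/-! ### The auxiliary initial value problem -/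

section

open Filter Topology
open ContinuousLinearMap (adjoint)

variable {n r : ℕ} {f : Vec n × Vec r → Vec n}

theorem totalShift_zero_right (x : Vec n) : totalShift f x 0 = 0 := by
  have : ∀ k, shift f x k 0 = 0 := by
    intro k
    induction k with
    | zero => rfl
    | succ k ih => simp [shift, ih]
  exact this _

theorem coeffP_one (x : Vec n) {τ : ℝ} (hτ : 0 ≤ τ) :
    coeffP f x 1 τ = expTime τ • stateCoeff f x (expTime τ) := by
  rw [coeffP, expTime_of_nonneg hτ, one_mul, neg_one_mul]
  rfl

theorem coeffQ_one (x : Vec n) {τ : ℝ} (hτ : 0 ≤ τ) :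
    coeffQ f x 1 τ = expTime τ • inputCoeff f x (expTime τ) := by
  rw [coeffQ, expTime_of_nonneg hτ, one_mul, neg_one_mul]
  rfl

theorem norm_pair_le {E U : Type*} [NormedAddCommGroup E] [NormedSpace ℝ E]
    [NormedAddCommGroup U] [NormedSpace ℝ U] (M : E →L[ℝ] U) (v : E) :
    ‖(v, M v)‖ ≤ (1 + ‖M‖) * ‖v‖ := by
  have h1 := M.le_opNorm v
  have h2 : 0 ≤ ‖M‖ * ‖v‖ := by positivity
  have h3 := norm_nonneg v
  rw [Prod.norm_mk]
  refine max_le ?_ ?_ <;> linarith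

theorem isStabilizing_of_isGramian {m k : ℕ} {c C : ℝ} {x : Vec n}
    {W W' : ℝ → Vec n →L[ℝ] Vec n} (hc : 0 < c) (hC : 0 < C)
    (h : IsGramian m k c C (stateCoeff f x) (inputCoeff f x) W W') :
    IsStabilizing (coeffP f x 1) (coeffQ f x 1) (feedback (inputCoeff f x) W) := by
  have hPc : Continuous (stateCoeff f x) := (contDiff_alongPoly f _ _ x 0).continuous
  have hQc : Continuous (inputCoeff f x) := (contDiff_alongPoly f _ _ x 0).continuous
  obtain ⟨Φ, hΦ0, hΦ, hK⟩ := h.exists_fundamental hc hC hPc hQc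
  refine ⟨(h.continuous_feedback hc hQc).continuousOn, Φ, hΦ0, fun τ hτ => ?_, hK⟩
  rw [coeffP_one x hτ, coeffQ_one x hτ]
  exact (hΦ τ hτ).hasDerivWithinAt

/-- Uniqueness for the auxiliary initial value problem. -/
theorem IsAuxSolution.eqOn (hf : ContDiff ℝ 1 f) {x : Vec n} {α : ℝ}
    {M : ℝ → Vec n →L[ℝ] Vec r} (hM : Continuous M) {y z : ℝ → Vec n}
    (hy : IsAuxSolution f x α M y) (hz : IsAuxSolution f x α M z) : EqOn y z (Ici 0) := by
  refine eqOn_of_solutions (fun τ y => (α * Real.exp (-α * τ)) •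
      (f (x + totalShift f x (Real.exp (-α * τ)) + y, M τ y)
        + deriv (totalShift f x) (Real.exp (-α * τ)))) (fun T ρ => ?_) y z hy.ode hz.ode
    (hy.initial.trans hz.initial.symm)
  have hp : Continuous (totalShift f x) := (contDiff_shift f x 0 _).continuous
  obtain ⟨a, ha⟩ := isCompact_Icc.exists_bound_of_continuousOn (s := Icc 0 T)
    (f := fun τ => x + totalShift f x (Real.exp (-α * τ))) (by fun_prop)
  obtain ⟨b, hb⟩ := isCompact_Icc.exists_bound_of_continuousOn (s := Icc 0 T)
    hM.continuousOn
  obtain ⟨e, he⟩ := isCompact_Icc.exists_bound_of_continuousOn (s := Icc 0 T)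
    (f := fun τ => α * Real.exp (-α * τ)) (by fun_prop)
  obtain ⟨L, hL⟩ := exists_lipschitzOnWith_closedBall hf (a + (1 + b) * ρ)
  refine ⟨(e * (L * (1 + b))).toNNReal, fun t ht => ?_⟩
  have hb0 : 0 ≤ b := (norm_nonneg _).trans (hb t ht)
  have he0 : 0 ≤ e := (norm_nonneg _).trans (he t ht)
  have hsplit : ∀ v : Vec n, (x + totalShift f x (Real.exp (-α * t)) + v, M t v)
      = (x + totalShift f x (Real.exp (-α * t)), 0) + (v, M t v) := fun v => by simp
  have hpair : ∀ v : Vec n, ‖(v, M t v)‖ ≤ (1 + b) * ‖v‖ := fun v =>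
    (norm_pair_le (M t) v).trans (by gcongr; exact hb t ht)
  have hmem : ∀ v ∈ Metric.closedBall (0 : Vec n) ρ,
      (x + totalShift f x (Real.exp (-α * t)) + v, M t v)
        ∈ Metric.closedBall (0 : Vec n × Vec r) (a + (1 + b) * ρ) := by
    intro v hv
    rw [mem_closedBall_zero_iff] at hv ⊢
    rw [hsplit]
    refine (norm_add_le _ _).trans (add_le_add ?_ ((hpair v).trans (by gcongr)))
    rw [Prod.norm_mk, norm_zero, max_eq_left (norm_nonneg _)]
    exact ha t ht
  rw [lipschitzOnWith_iff_norm_sub_le]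
  intro v hv w hw
  rw [← smul_sub, add_sub_add_right_eq_sub, norm_smul]
  have h1 := hL.norm_sub_le (hmem v hv) (hmem w hw)
  have h2 : (x + totalShift f x (Real.exp (-α * t)) + v, M t v)
      - (x + totalShift f x (Real.exp (-α * t)) + w, M t w) = (v - w, M t (v - w)) := by
    ext1 <;> simp
  rw [h2] at h1
  rw [Real.coe_toNNReal _ (by positivity)]
  calc _ ≤ e * (L * ((1 + b) * ‖v - w‖)) := by
        gcongr
        · exact he t ht
        · exact h1.trans (by gcongr; exact hpair _)
    _ = _ := by ring

/-- A solution of the auxiliary equation with `f` replaced by a globally Lipschitz `F`, and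
with the time variable frozen before `τ = 0`. -/
theorem exists_cutoff_solution {F : Vec n × Vec r → Vec n} {L : NNReal} (hF : LipschitzWith L F)
    (x : Vec n) {M : ℝ → Vec n →L[ℝ] Vec r} (hM : Continuous M) :
    ∃ y : ℝ → Vec n, y 0 = -x - totalShift f x 1 ∧ ∀ τ, 0 ≤ τ → HasDerivAt y (expTime τ •
      (F (x + totalShift f x (expTime τ) + y τ, M τ (y τ))
        + deriv (totalShift f x) (expTime τ))) τ := by
  have hp : ContDiff ℝ 1 (totalShift f x) := contDiff_shift f x 1 _
  have hpc := hp.continuous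
  have hpd : Continuous (deriv (totalShift f x)) := hp.continuous_deriv le_rfl
  have hFc := hF.continuous
  refine exists_global_solution (fun τ y => expTime τ •
      (F (x + totalShift f x (expTime τ) + y, M τ y) + deriv (totalShift f x) (expTime τ)))
    (fun τ => L * (1 + ‖M τ‖)) (by fun_prop) (fun τ => by positivity) ?_ ?_ _
  · have h1 : Continuous fun p : ℝ × Vec n => M p.1 p.2 :=
      (hM.comp continuous_fst).clm_apply continuous_snd
    fun_prop
  · intro t v w
    rw [← smul_sub, add_sub_add_right_eq_sub, norm_smul, Real.norm_eq_abs,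
      abs_of_pos (expTime_mem t).1]
    have h1 := hF.norm_sub_le (x + totalShift f x (expTime t) + v, M t v)
      (x + totalShift f x (expTime t) + w, M t w)
    have h2 : (x + totalShift f x (expTime t) + v, M t v)
        - (x + totalShift f x (expTime t) + w, M t w) = (v - w, M t (v - w)) := by
      ext1 <;> simp
    rw [h2] at h1
    calc _ ≤ 1 * (L * ((1 + ‖M t‖) * ‖v - w‖)) := by
          gcongr
          · exact (expTime_mem t).2
          · exact h1.trans (by gcongr; exact norm_pair_le _ _)
      _ = _ := by ring

/-- The deviation of the auxiliary equation from the linear closed system. -/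
theorem norm_perturbation_le {F : Vec n × Vec r → Vec n} (hF : Differentiable ℝ F) {L : NNReal}
    (hL : LipschitzWith L (fderiv ℝ F)) (hFf : ∀ z ∈ Metric.ball 0 1, F z = f z)
    {p v p' : Vec n} {d : Vec r} {P : Vec n →L[ℝ] Vec n} {Q : Vec r →L[ℝ] Vec n} {ρ a b : ℝ}
    (hp : ‖p‖ < 1) (hρ : ‖f (p, 0) + p'‖ ≤ ρ) (hP : ‖partialX f p - P‖ ≤ a)
    (hQ : ‖partialU f p - Q‖ ≤ b) :
    ‖F (p + v, d) + p' - P v - Q d‖ ≤ ρ + (a * ‖v‖ + b * ‖d‖ + L * max ‖v‖ ‖d‖ ^ 2) := by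
  have hmem : (p, (0 : Vec r)) ∈ Metric.ball (0 : Vec n × Vec r) 1 := by
    rw [mem_ball_zero_iff, Prod.norm_mk, norm_zero, max_eq_left (norm_nonneg _)]
    exact hp
  have hfd : fderiv ℝ F (p, 0) = fderiv ℝ f (p, 0) :=
    Filter.EventuallyEq.fderiv_eq
      (by filter_upwards [Metric.isOpen_ball.mem_nhds hmem] with z hz using hFf z hz)
  have h1 := norm_sub_fderiv_le hF hL (p, (0 : Vec r)) (v, d)
  rw [Prod.mk_add_mk, zero_add, Prod.norm_mk, hfd, hFf _ hmem] at h1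
  have h2 : fderiv ℝ f (p, 0) (v, d) = partialX f p v + partialU f p d := by
    simp only [partialX, partialU, ContinuousLinearMap.comp_apply, ContinuousLinearMap.inl_apply,
      ContinuousLinearMap.inr_apply]
    rw [← map_add]
    simp
  rw [h2] at h1
  have h3 : F (p + v, d) + p' - P v - Q d = (f (p, 0) + p')
      + ((partialX f p - P) v + (partialU f p - Q) d
        + (F (p + v, d) - f (p, 0) - (partialX f p v + partialU f p d))) := by
    simp only [sub_apply]
    abel
  have h4 : ‖(partialX f p - P) v‖ ≤ a * ‖v‖ :=
    ((partialX f p - P).le_opNorm v).trans (by gcongr)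
  have h5 : ‖(partialU f p - Q) d‖ ≤ b * ‖d‖ :=
    ((partialU f p - Q).le_opNorm d).trans (by gcongr)
  rw [h3]
  exact (norm_add_le _ _).trans (add_le_add hρ ((norm_add_le _ _).trans
    (add_le_add ((norm_add_le _ _).trans (add_le_add h4 h5)) h1)))

theorem tendsto_zero_of_sq_norm_le {G : Type*} [NormedAddCommGroup G] {y : ℝ → G} {K : ℝ}
    (h : ∀ τ, 0 ≤ τ → ‖y τ‖ ^ 2 ≤ K * expTime τ) : Tendsto y atTop (𝓝 0) := by
  have h1 : Tendsto (fun τ : ℝ => K * Real.exp (-τ)) atTop (𝓝 (K * 0)) :=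
    (Real.tendsto_exp_neg_atTop_nhds_zero).const_mul K
  rw [mul_zero] at h1
  have h2 : Tendsto (fun τ => ‖y τ‖ ^ 2) atTop (𝓝 0) := by
    refine tendsto_of_tendsto_of_tendsto_of_le_of_le' tendsto_const_nhds h1
      (Eventually.of_forall fun τ => by positivity) ?_
    filter_upwards [eventually_ge_atTop 0] with τ hτ
    rw [← expTime_of_nonneg hτ]
    exact h τ hτ
  have h3 := h2.sqrt
  simp only [Real.sqrt_sq (norm_nonneg _), Real.sqrt_zero] at h3
  exact tendsto_zero_iff_norm_tendsto_zero.2 h3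

end

/-! ### Solution of the transfer problem -/

section

open Filter Topology

/-- The transfer problem in positive dimension, with `α = 1`. -/
theorem exists_transfer {n r : ℕ} (f : Vec (n + 1) × Vec r → Vec (n + 1))
    (hf : ContDiff ℝ ((4 * (n + 1) : ℕ) : WithTop ℕ∞) f) (hf0 : f (0, 0) = 0)
    (hrank : (kalmanMatrix (matA f) (matB f)).rank = n + 1) {N : ℝ} (hN : 0 < N) :
    ∃ ε > (0 : ℝ), ∀ x₁ : Vec (n + 1), ‖x₁‖ < ε →
      ∃ (M : ℝ → Vec (n + 1) →L[ℝ] Vec r) (y x : ℝ → Vec (n + 1)) (u : ℝ → Vec r),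
        IsStabilizing (coeffP f x₁ 1) (coeffQ f x₁ 1) M ∧ IsAuxSolution f x₁ 1 M y ∧
        (∀ y', IsAuxSolution f x₁ 1 M y' → EqOn y' y (Ici 0)) ∧
        (∀ τ ∈ Ici (0 : ℝ),
          x (1 - Real.exp (-1 * τ)) = x₁ + totalShift f x₁ (Real.exp (-1 * τ)) + y τ ∧
          u (1 - Real.exp (-1 * τ)) = M τ (y τ)) ∧
        IsSolution f N x₁ x u := by
  have hn : 0 < n + 1 := n.succ_pos
  have hf1 : ContDiff ℝ 1 f := hf.of_le (by norm_cast; omega)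
  have hf2 : ContDiff ℝ 2 f := hf.of_le (by norm_cast; omega)
  have hfX : ContDiff ℝ ((n + 1 : ℕ) : WithTop ℕ∞) (partialX f) :=
    contDiff_partialX f (hf.of_le (by norm_cast; omega))
  have hfU : ContDiff ℝ ((2 * (n + 1) : ℕ) : WithTop ℕ∞) (partialU f) :=
    contDiff_partialU f (hf.of_le (by norm_cast; omega))
  -- constants that do not depend on the target
  obtain ⟨c₀, hc₀, b, hb0, hctrl⟩ := eventually_ctrlSeq_bounds f hn hf hf0 hrank
  obtain ⟨c, hc, C, hC, hgram⟩ := exists_isGramian (E := Vec (n + 1)) (r := r) (6 * n + 6) n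
    (b := b) hc₀
  obtain ⟨a₁, ha₁, hX⟩ := norm_sub_along_le f hn hf hf0 hfX
  obtain ⟨a₂, ha₂, hU⟩ := norm_sub_along_le f hn hf hf0 hfU
  obtain ⟨F, hF2, hFf, ⟨L, hL⟩, ⟨L', hL'⟩⟩ := exists_lipschitz_cutoff hf2
  obtain ⟨K, hK, hdecay⟩ := IsGramian.lyap_le_of_perturbation (E := Vec (n + 1)) (r := r)
    (B := a₁ + a₂ + L') n hc hC hb0 (by positivity)
  -- `β` is the final size of the Lyapunov function, `e` that of the residual
  set δ : ℝ := min N (1 / 2) with hδ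
  have hδ0 : 0 < δ := lt_min hN (by norm_num)
  set β : ℝ := min 1 (δ ^ 2 / (2 * K)) with hβ
  have hβ0 : 0 < β := lt_min one_pos (by positivity)
  have hβ1 : β ≤ 1 := min_le_left _ _
  have hKβ : K * β < δ ^ 2 := by
    have h1 : β ≤ δ ^ 2 / (2 * K) := min_le_right _ _
    rw [le_div_iff₀ (by positivity)] at h1
    have : 0 < δ ^ 2 := by positivity
    linarith
  set e : ℝ := min 1 (β / K) with he
  have he0 : 0 < e := lt_min one_pos (by positivity)
  have heβ : K * e ≤ β := by
    have h1 : e ≤ β / K := min_le_right _ _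
    rw [le_div_iff₀ hK] at h1
    linarith
  have hev := hctrl.and (hX.and (hU.and ((residual_le f hn hf hf0 he0).and
    ((eventually_norm_totalShift_lt f hn hf hf0 (by norm_num : (0 : ℝ) < 1 / 2)).and
      (eventually_norm_totalShift_lt f hn hf hf0
        (Real.sqrt_pos.2 (div_pos hβ0 hK)))))))
  obtain ⟨ε, hε, hball⟩ := Metric.eventually_nhds_iff.1 hev
  refine ⟨ε, hε, fun x₁ hx₁ => ?_⟩
  obtain ⟨hctrl, hX, hU, hres, hhalf, hsmall⟩ := hball (by simpa using hx₁)
  obtain ⟨W, W', hW⟩ := hgram (stateCoeff f x₁) (ctrlSeq (stateCoeff f x₁) (inputCoeff f x₁))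
    (fun k s => hasDerivAt_ctrlSeq (differentiable_ctrlSeq f x₁ k) s)
    (fun s hs => (hctrl s ⟨hs.1.le, hs.2⟩).1) (fun s hs => (hctrl s ⟨hs.1.le, hs.2⟩).2)
  set P := stateCoeff f x₁ with hP
  set Q := inputCoeff f x₁ with hQ
  set p := totalShift f x₁ with hp
  change IsGramian (6 * n + 6) n c C P Q W W' at hW
  have hQc : Continuous Q := (contDiff_alongPoly f _ _ x₁ 0).continuous
  set M := feedback Q W with hM
  have hMc : Continuous M := hW.continuous_feedback hc hQc
  obtain ⟨y, hy0, hy⟩ := exists_cutoff_solution hL x₁ hMc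
  have hsI : ∀ τ, expTime τ ∈ Icc (0 : ℝ) 1 := fun τ => ⟨(expTime_mem τ).1.le, (expTime_mem τ).2⟩
  set g : ℝ → Vec (n + 1) := fun τ => F (x₁ + p (expTime τ) + y τ, M τ (y τ))
    + deriv p (expTime τ) - P (expTime τ) (y τ) - Q (expTime τ) (M τ (y τ)) with hg
  have hgb : ∀ τ, 0 ≤ τ → ‖g τ‖ ≤ e * expTime τ ^ (4 * n + 3)
      + (a₁ + a₂ + L') * (expTime τ ^ (n + 1) * ‖y τ‖ + expTime τ ^ (2 * n + 2) * ‖M τ (y τ)‖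
        + max ‖y τ‖ ‖M τ (y τ)‖ ^ 2) := by
    intro τ _
    have hs := hsI τ
    have h1 := norm_perturbation_le (hF2.differentiable (by simp)) hL' hFf (v := y τ)
      (d := M τ (y τ)) ((hhalf _ hs).trans (by norm_num)) (hres _ hs) (hX _ hs) (hU _ hs)
    refine h1.trans (add_le_add (le_of_eq ?_) ?_)
    · congr 2
    · have e1 : 0 ≤ expTime τ ^ (n + 1) * ‖y τ‖ := by have := hs.1; positivity
      have e2 : 0 ≤ expTime τ ^ (2 * n + 2) * ‖M τ (y τ)‖ := by have := hs.1; positivity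
      have e3 : 0 ≤ max ‖y τ‖ ‖M τ (y τ)‖ ^ 2 := by positivity
      have hL0 : 0 ≤ (L' : ℝ) := L'.2
      have e4 : 2 * (n + 1) = 2 * n + 2 := by ring
      rw [e4]
      nlinarith [mul_nonneg ha₂ e1, mul_nonneg hL0 e1, mul_nonneg ha₁ e2, mul_nonneg hL0 e2,
        mul_nonneg ha₁ e3, mul_nonneg ha₂ e3]
  have hbound := hdecay P Q W W' hW
    (fun s hs => (hctrl s ⟨hs.1.le, hs.2⟩).1 0 (Nat.zero_le _)) e β y g he0.le (min_le_left _ _)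
    hβ0 hβ1 heβ ?_ (fun τ hτ => ?_) hgb
  rotate_left
  · have h1 : y 0 = -(x₁ + p 1) := by rw [hy0]; abel
    have h2 := hsmall 1 (by simp)
    rw [h1, norm_neg]
    have h3 : ‖x₁ + p 1‖ ^ 2 ≤ Real.sqrt (β / K) ^ 2 := by gcongr
    rw [Real.sq_sqrt (by positivity), le_div_iff₀ hK] at h3
    linarith
  · refine ((hy τ hτ).congr_deriv ?_).hasDerivWithinAt
    simp only [hg]
    congr 1
    abel
  have hsize : ∀ {G : Type} [NormedAddCommGroup G] (v : G) (τ : ℝ),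
      ‖v‖ ^ 2 ≤ K * β * expTime τ → ‖v‖ < δ := by
    intro G _ v τ hv
    have h1 : K * β * expTime τ ≤ K * β * 1 := by
      have := (expTime_mem τ).2
      gcongr
    exact lt_of_pow_lt_pow_left₀ 2 hδ0.le (by linarith)
  -- the trajectory stays where the modified right-hand side is the original one
  have hFy : ∀ τ, 0 ≤ τ → F (x₁ + p (expTime τ) + y τ, M τ (y τ))
      = f (x₁ + p (expTime τ) + y τ, M τ (y τ)) := by
    intro τ hτ
    refine hFf _ ?_
    have h1 := hsize _ τ (hbound τ hτ).1
    have h2 := hsize _ τ (hbound τ hτ).2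
    have h3 := hhalf _ (hsI τ)
    have h4 : δ ≤ 1 / 2 := min_le_right _ _
    rw [mem_ball_zero_iff, Prod.norm_mk]
    refine max_lt ((norm_add_le _ _).trans_lt ?_) ?_ <;> linarith
  have hyf : ∀ τ, 0 ≤ τ → HasDerivWithinAt y (Real.exp (-τ) •
      (f (x₁ + p (Real.exp (-τ)) + y τ, M τ (y τ)) + deriv p (Real.exp (-τ)))) (Ici 0) τ := by
    intro τ hτ
    have h1 := (hy τ hτ).hasDerivWithinAt (s := Ici 0)
    rw [hFy τ hτ, expTime_of_nonneg hτ] at h1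
    exact h1
  have haux : IsAuxSolution f x₁ 1 M y := by
    refine ⟨hy0, fun τ hτ => ?_⟩
    rw [one_mul, neg_one_mul]
    exact hyf τ hτ
  have hyc : ContinuousOn y (Ici 0) := fun τ hτ => (hyf τ hτ).continuousWithinAt
  obtain ⟨x, u, hxu, hsol⟩ := exists_isSolution hf1.continuous hN
    (contDiff_shift f x₁ 1 _) (totalShift_zero_right x₁) hy0 hyf
    (hMc.continuousOn.clm_apply hyc)
    (fun τ hτ => (hsize _ τ (hbound τ hτ).2).trans_le (min_le_left _ _))
    (tendsto_zero_of_sq_norm_le fun τ hτ => (hbound τ hτ).1)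
    (tendsto_zero_of_sq_norm_le fun τ hτ => (hbound τ hτ).2)
  refine ⟨M, y, x, u, isStabilizing_of_isGramian hc hC hW, haux,
    fun y' hy' => hy'.eqOn hf1 hMc haux, fun τ hτ => ?_, hsol⟩
  rw [neg_one_mul]
  exact hxu τ hτ

/-- In dimension zero all trajectories vanish. -/
theorem exists_transfer_of_dim_zero {r : ℕ} (hr : r ≤ 0) (f : Vec 0 × Vec r → Vec 0) {N : ℝ}
    (hN : 0 < N) (x₁ : Vec 0) :
      ∃ (M : ℝ → Vec 0 →L[ℝ] Vec r) (y x : ℝ → Vec 0) (u : ℝ → Vec r),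
        IsStabilizing (coeffP f x₁ 1) (coeffQ f x₁ 1) M ∧ IsAuxSolution f x₁ 1 M y ∧
        (∀ y', IsAuxSolution f x₁ 1 M y' → EqOn y' y (Ici 0)) ∧
        (∀ τ ∈ Ici (0 : ℝ),
          x (1 - Real.exp (-1 * τ)) = x₁ + totalShift f x₁ (Real.exp (-1 * τ)) + y τ ∧
          u (1 - Real.exp (-1 * τ)) = M τ (y τ)) ∧
        IsSolution f N x₁ x u := by
  obtain rfl : r = 0 := Nat.le_zero.1 hr
  refine ⟨fun _ => 0, fun _ => 0, fun _ => 0, fun _ => 0,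
    ⟨continuousOn_const, fun _ => 0, Subsingleton.elim _ _, fun τ _ => ?_, 1, one_pos, 1, one_pos,
      fun τ _ => ?_⟩,
    ⟨Subsingleton.elim _ _, fun τ _ => ?_⟩, fun y' _ τ _ => Subsingleton.elim _ _,
    fun τ _ => ⟨Subsingleton.elim _ _, Subsingleton.elim _ _⟩,
    continuousOn_const, continuousOn_const, fun t _ => ?_, fun t _ => by simpa using hN,
    rfl, Subsingleton.elim _ _⟩
  · exact (hasDerivWithinAt_const τ _ _).congr_deriv (Subsingleton.elim _ _)
  · rw [norm_zero]; positivity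
  · exact (hasDerivWithinAt_const τ _ _).congr_deriv (Subsingleton.elim _ _)
  · exact (hasDerivWithinAt_const t _ _).congr_deriv (Subsingleton.elim _ _)

end

end TransferControl

end

theorem mainTheorem1 (n r : ℕ) (hr : r ≤ n)
    (f : TransferControl.Vec n × TransferControl.Vec r → TransferControl.Vec n)
    (hf : ContDiff ℝ ((4 * n : ℕ) : WithTop ℕ∞) f) (hf0 : f (0, 0) = 0)
    (hrank : (TransferControl.kalmanMatrix
      (TransferControl.matA f) (TransferControl.matB f)).rank = n)
    (N : ℝ) (hN : 0 < N) :
    ∃ ε > (0 : ℝ), ∃ α > (0 : ℝ), ∀ xbar : TransferControl.Vec n, ‖xbar‖ < ε →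
      ∃ (M : ℝ → TransferControl.Vec n →L[ℝ] TransferControl.Vec r)
        (y : ℝ → TransferControl.Vec n)
        (x : ℝ → TransferControl.Vec n) (u : ℝ → TransferControl.Vec r),
        TransferControl.IsStabilizing (TransferControl.coeffP f xbar α)
          (TransferControl.coeffQ f xbar α) M ∧
        TransferControl.IsAuxSolution f xbar α M y ∧
        (∀ y' : ℝ → TransferControl.Vec n, TransferControl.IsAuxSolution f xbar α M y' →
          Set.EqOn y' y (Set.Ici 0)) ∧
        (∀ τ ∈ Set.Ici (0 : ℝ),
          x (1 - Real.exp (-α * τ))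
            = xbar + TransferControl.totalShift f xbar (Real.exp (-α * τ)) + y τ ∧
          u (1 - Real.exp (-α * τ)) = M τ (y τ)) ∧
        TransferControl.IsSolution f N xbar x u := by
  rcases n with _ | n
  · exact ⟨1, one_pos, 1, one_pos, fun x₁ _ =>
      TransferControl.exists_transfer_of_dim_zero hr f hN x₁⟩
  · obtain ⟨ε, hε, h⟩ := TransferControl.exists_transfer f hf hf0 hrank hN
    exact ⟨ε, hε, 1, one_pos, h⟩
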